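/- All Hilbert spaces are finite-dimensional and nonzero. Let $\mathcal N:\mathbb B(\mathcal H_A)\to\mathbb B(\mathcal H_B)$ and $\mathcal M:\mathbb B(\mathcal H_{A'})\to\mathbb B(\mathcal H_{B'})$ be quantum channels (completely positive trace-preserving linear maps). An isometry $U:\mathcal H_A\to\mathcal H_B\otimes\mathcal H_E$ generates $\mathcal N$ together with the complementary channel $\mathcal N^c$ if $\mathcal N(X)=\operatorname{Tr}_E(UXU^\dagger)$ and $\mathcal N^c(X)=\operatorname{Tr}_B(UXU^\dagger)$; $\mathcal N^c$ is determined up to an isometry on $E$. Write $S(\rho)=-\operatorname{Tr}(\rho\log\rho)$ and, for a bipartite state, $I(V;B)=S(\rho_V)+S(\rho_B)-S(\rho_{VB})$. The maximal coherent information of a channel $\mathcal N$ is $$\mathcal Q^{(1)}(\mathcal N)=\max_{\rho_A}\bigl(S(\rho_B)-S(\rho_{RB})\bigr),$$ where $\rho_A$ ranges over all states on $\mathcal H_A$, $|\psi\rangle_{RA}$ is a purification of $\rho_A$, $\rho_{RB}=(\mathrm{id}_R\otimes\mathcal N)(|\psi\rangle\langle\psi|)$ and $\rho_B=\mathcal N(\rho_A)$.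 The channel $\mathcal N$ is *informationally degradable* if, for every finite-dimensional system $\mathcal H_V$ and every state $\rho_{VA}$ on $\mathcal H_V\otimes\mathcal H_A$, $I(V;B)\ge I(V;E)$, where $\rho_{VB}=(\mathrm{id}_V\otimes\mathcal N)(\rho_{VA})$ and $\rho_{VE}=(\mathrm{id}_V\otimes\mathcal N^c)(\rho_{VA})$. It is *regularized less noisy* if, for every $n\ge1$, every finite set $\mathcal X$ and every classical-quantum state $\rho_{\mathcal XA^n}=\sum_{x\in\mathcal X}p(x)|x\rangle\langle x|\otimes\rho^x_{A^n}$ (with $p$ a probability distribution and each $\rho^x_{A^n}$ a state on $\mathcal H_A^{\otimes n}$), $I(\mathcal X;B^n)\ge I(\mathcal X;E^n)$, where $\rho_{\mathcal XB^n}=(\mathrm{id}\otimes\mathcal N^{\otimes n})(\rho_{\mathcal XA^n})$ and $\rho_{\mathcal XE^n}=(\mathrm{id}\otimes(\mathcal N^c)^{\otimes n})(\rho_{\mathcal XA^n})$. Theorem. 1. If $\mathcal N$ is regularized less noisy, then $\mathcal Q^{(1)}(\mathcal N^{\otimes n})=n\,\mathcal Q^{(1)}(\mathcal N)$ for every $n\ge1$.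 2. If $\mathcal N$ and $\mathcal M$ are informationally degradable, then $\mathcal Q^{(1)}(\mathcal N^{\otimes n}\otimes\mathcal M^{\otimes m})=n\,\mathcal Q^{(1)}(\mathcal N)+m\,\mathcal Q^{(1)}(\mathcal M)$ for all $n,m\ge1$. In particular, $\mathcal Q^{(1)}(\mathcal N^{\otimes n})=n\,\mathcal Q^{(1)}(\mathcal N)$ for every informationally degradable channel $\mathcal N$ and every $n\ge1$. -/

import Mathlib

open scoped Kronecker ComplexOrder

noncomputable section

namespace QInfo

/-- Super-operators from `𝔹(ℂ^A)` to `𝔹(ℂ^B)`; a finite-dimensional system is modelled by the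
finite index set of an orthonormal basis. -/
abbrev Superop (A B : Type) : Type := Matrix A A ℂ →ₗ[ℂ] Matrix B B ℂ

/-- Quantum states (density matrices). -/
def IsState {A : Type} [Fintype A] (ρ : Matrix A A ℂ) : Prop :=
  ρ.PosSemidef ∧ ρ.trace = 1

/-- `Tr_E` on `H_B ⊗ H_E`. -/
def ptraceRight {B E : Type} [Fintype E] (X : Matrix (B × E) (B × E) ℂ) : Matrix B B ℂ :=
  Matrix.of fun b c => ∑ e, X (b, e) (c, e)

/-- `Tr_B` on `H_B ⊗ H_E`. -/
def ptraceLeft {B E : Type} [Fintype B] (X : Matrix (B × E) (B × E) ℂ) : Matrix E E ℂ :=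
  Matrix.of fun e f => ∑ b, X (b, e) (b, f)

section Tensor

variable {A B A' B' : Type} [Fintype A] [DecidableEq A] [Fintype A'] [DecidableEq A']

/-- The tensor product `Φ ⊗ Ψ` of super-operators: the linear map with
`(Φ ⊗ Ψ)(X ⊗ Y) = Φ(X) ⊗ Ψ(Y)`, written out on matrix units. -/
def tensor (Φ : Superop A B) (Ψ : Superop A' B') : Superop (A × A') (B × B') where
  toFun X := ∑ p : A × A', ∑ q : A × A',
    X p q • (Φ (Matrix.single p.1 q.1 1) ⊗ₖ Ψ (Matrix.single p.2 q.2 1))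
  map_add' X Y := by simp [add_smul, Finset.sum_add_distrib]
  map_smul' c X := by simp [mul_smul, Finset.smul_sum]

/-- The tensor power `Φ^{⊗ n}`, where the basis of the `n`-fold tensor power of `ℂ^A` is indexed by
`Fin n → A`: the linear map with `Φ^{⊗ n}(X₁ ⊗ ⋯ ⊗ Xₙ) = Φ(X₁) ⊗ ⋯ ⊗ Φ(Xₙ)`. -/
def tensorPow (n : ℕ) (Φ : Superop A B) : Superop (Fin n → A) (Fin n → B) where
  toFun X := ∑ p : Fin n → A, ∑ q : Fin n → A,
    X p q • Matrix.of fun b c => ∏ i, Φ (Matrix.single (p i) (q i) 1) (b i) (c i)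
  map_add' X Y := by simp only [Matrix.add_apply, add_smul, Finset.sum_add_distrib]
  map_smul' c X := by
    simp only [Matrix.smul_apply, smul_eq_mul, mul_smul, Finset.smul_sum, RingHom.id_apply]

theorem tensor_kronecker (Φ : Superop A B) (Ψ : Superop A' B')
    (X : Matrix A A ℂ) (Y : Matrix A' A' ℂ) :
    tensor Φ Ψ (X ⊗ₖ Y) = Φ X ⊗ₖ Ψ Y := by
  have hX : Φ X = ∑ a, ∑ b, X a b • Φ (Matrix.single a b 1) := by
    conv_lhs => rw [Matrix.matrix_eq_sum_single X]
    simp only [map_sum, ← map_smul, Matrix.smul_single, smul_eq_mul, mul_one]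
  have hY : Ψ Y = ∑ a, ∑ b, Y a b • Ψ (Matrix.single a b 1) := by
    conv_lhs => rw [Matrix.matrix_eq_sum_single Y]
    simp only [map_sum, ← map_smul, Matrix.smul_single, smul_eq_mul, mul_one]
  ext ⟨b, b'⟩ ⟨c, c'⟩
  rw [hX, hY]
  simp only [tensor, LinearMap.coe_mk, AddHom.coe_mk, Matrix.kroneckerMap_apply,
    Matrix.sum_apply, Matrix.smul_apply, smul_eq_mul, Fintype.sum_prod_type,
    Finset.sum_mul_sum]
  refine Finset.sum_congr rfl fun a _ => Finset.sum_congr rfl fun a' _ =>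
    Finset.sum_congr rfl fun d _ => Finset.sum_congr rfl fun d' _ => ?_
  ring

theorem tensorPow_prod (n : ℕ) (Φ : Superop A B) (X : Fin n → Matrix A A ℂ) :
    tensorPow n Φ (Matrix.of fun p q => ∏ i, X i (p i) (q i)) =
      Matrix.of fun b c => ∏ i, Φ (X i) (b i) (c i) := by
  have hX (i : Fin n) : Φ (X i) = ∑ p : A × A, X i p.1 p.2 • Φ (Matrix.single p.1 p.2 1) := by
    conv_lhs => rw [Matrix.matrix_eq_sum_single (X i)]
    simp only [map_sum, ← map_smul, Matrix.smul_single, smul_eq_mul, mul_one,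
      Fintype.sum_prod_type]
  ext b c
  simp only [tensorPow, LinearMap.coe_mk, AddHom.coe_mk, Matrix.sum_apply, Matrix.smul_apply,
    Matrix.of_apply, smul_eq_mul, hX, Finset.prod_univ_sum, Fintype.piFinset_univ]
  rw [← Fintype.sum_prod_type']
  refine (Fintype.sum_equiv (Equiv.arrowProdEquivProdArrow (Fin n) (fun _ => A) (fun _ => A))
    _ _ fun f => ?_).symm
  simp [Equiv.arrowProdEquivProdArrow, Finset.prod_mul_distrib]

end Tensor

section Entropy

variable {A B V : Type} [Fintype A] [DecidableEq A] [Fintype B] [DecidableEq B]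
  [Fintype V] [DecidableEq V]

/-- The von Neumann entropy `S(ρ) = -Tr(ρ log ρ)`, with the logarithm taken by functional calculus;
`Real.log 0 = 0` implements `0 log 0 = 0`. -/
def vonNeumannEntropy (ρ : Matrix A A ℂ) : ℝ :=
  -((ρ * cfc Real.log ρ).trace).re

/-- The mutual information `I(V;B) = S(ρ_V) + S(ρ_B) - S(ρ_VB)`. -/
def mutualInfo (ρ : Matrix (V × B) (V × B) ℂ) : ℝ :=
  vonNeumannEntropy (ptraceRight ρ) + vonNeumannEntropy (ptraceLeft ρ) - vonNeumannEntropy ρ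

/-- The canonical purification `|ψ⟩ = ∑ₐᵣ (√ρ)ₐᵣ |r⟩ ⊗ |a⟩` of `ρ` on `H_R ⊗ H_A`, with `R = A`, given
as the rank-one density matrix `|ψ⟩⟨ψ|`. -/
def purification (ρ : Matrix A A ℂ) : Matrix (A × A) (A × A) ℂ :=
  let ψ : A × A → ℂ := fun x => cfc Real.sqrt ρ x.2 x.1
  Matrix.vecMulVec ψ (star ψ)

/-- The coherent information `I_c(ρ, Φ) = S(ρ_B) - S(ρ_RB)`, where `ρ_B = Φ(ρ)` and
`ρ_RB = (id_R ⊗ Φ)(|ψ⟩⟨ψ|)` for a purification `|ψ⟩` of `ρ`. -/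
def coherentInfo (ρ : Matrix A A ℂ) (Φ : Superop A B) : ℝ :=
  vonNeumannEntropy (Φ ρ) -
    vonNeumannEntropy (tensor (LinearMap.id : Superop A A) Φ (purification ρ))

/-- The maximal coherent information `Q⁽¹⁾(Φ) = max_ρ I_c(ρ, Φ)`. -/
def maxCoherentInfo (Φ : Superop A B) : ℝ :=
  sSup {x : ℝ | ∃ ρ : Matrix A A ℂ, IsState ρ ∧ x = coherentInfo ρ Φ}

end Entropy

section Channels

variable {A B E : Type} [Fintype A] [DecidableEq A] [Fintype B] [DecidableEq B] [Fintype E]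

/-- Quantum channels: completely positive trace-preserving super-operators. -/
def IsChannel (N : Superop A B) : Prop :=
  (∀ (k : ℕ) (X : Matrix (Fin k × A) (Fin k × A) ℂ), X.PosSemidef →
    (tensor (LinearMap.id : Superop (Fin k) (Fin k)) N X).PosSemidef) ∧
  ∀ X : Matrix A A ℂ, (N X).trace = X.trace

/-- `(N, Nc)` is the complementary pair generated by some isometry `U : H_A → H_B ⊗ H_E`:
`N(X) = Tr_E(U X U†)` and `Nc(X) = Tr_B(U X U†)`. -/
def IsComplementaryPair (N : Superop A B) (Nc : Superop A E) : Prop :=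
  ∃ U : Matrix (B × E) A ℂ, U.conjTranspose * U = 1 ∧
    (∀ X, N X = ptraceRight (U * X * U.conjTranspose)) ∧
    (∀ X, Nc X = ptraceLeft (U * X * U.conjTranspose))

/-- The classical-quantum operator `∑ₓ p(x) |x⟩⟨x| ⊗ σˣ`. -/
def cqState {X : Type} [Fintype X] [DecidableEq X] (p : X → ℝ) (σ : X → Matrix A A ℂ) :
    Matrix (X × A) (X × A) ℂ :=
  ∑ x, (p x : ℂ) • (Matrix.single x x (1 : ℂ) ⊗ₖ σ x)

/-- `N` is informationally degradable: `I(V;B) ≥ I(V;E)` for every system `V` and every state of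
`V` and `A`. A complementary channel is unique up to an isometry on the environment, which changes
no entropy, so that it does not matter which one is used. -/
def InformationallyDegradable (N : Superop A B) : Prop :=
  ∃ (e : ℕ) (Nc : Superop A (Fin e)), IsComplementaryPair N Nc ∧
    ∀ (V : Type) [Fintype V] [DecidableEq V] (ρ : Matrix (V × A) (V × A) ℂ), IsState ρ →
      mutualInfo (tensor (LinearMap.id : Superop V V) Nc ρ) ≤
        mutualInfo (tensor (LinearMap.id : Superop V V) N ρ)

/-- `N` is regularized less noisy: `I(X;Bⁿ) ≥ I(X;Eⁿ)` for every `n ≥ 1`, every classical system `X`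
and every classical-quantum state of `X` and `Aⁿ`. -/
def RegularizedLessNoisy (N : Superop A B) : Prop :=
  ∃ (e : ℕ) (Nc : Superop A (Fin e)), IsComplementaryPair N Nc ∧
    ∀ (n : ℕ), 1 ≤ n → ∀ (X : Type) [Fintype X] [DecidableEq X] (p : X → ℝ)
      (σ : X → Matrix (Fin n → A) (Fin n → A) ℂ),
      (∀ x, 0 ≤ p x) → ∑ x, p x = 1 → (∀ x, IsState (σ x)) →
      mutualInfo (tensor (LinearMap.id : Superop X X) (tensorPow n Nc) (cqState p σ)) ≤
        mutualInfo (tensor (LinearMap.id : Superop X X) (tensorPow n N) (cqState p σ))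

end Channels

end QInfo

end

/-!
# Additivity of the maximal coherent information

Let `(N, Nc)` be a complementary pair, generated by an isometry `U : H_A → H_B ⊗ H_E`. If `ρ` is
purified, then reference, output and environment are jointly pure, so `S(RB) = S(E)` and the
coherent information is the entropy difference `F(ρ) = S(N(ρ)) - S(Nc(ρ))`, here `entropyGap`
(`coherentInfo_eq_entropyGap`). Since `F` is additive on product states, the maximum of a tensor
product is at least the sum of the maxima (`mul_maxCoherentInfo_le`, `maxCoherentInfo_add_le`). The
content of the theorem is the opposite inequality.

*Informationally degradable channels.* In `I(V;B) ≥ I(V;E)` the term `S(V)` cancels, which leaves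
`S(VB) - S(VE) ≤ F(ρ_A) ≤ Q⁽¹⁾(N)` for every bystander `V`, the property `StableGapLE`. A bound of
this kind is additive under tensor products (`StableGapLE.tensor`): the outputs are exchanged for
the environments one factor at a time, all other systems being absorbed into the bystander. The
trivial bystander then gives the upper bound on `F`.

*Regularized less noisy channels.* For a two-letter ensemble, `I(X;Bⁿ) ≥ I(X;Eⁿ)` says that the
entropy difference `F` of `N^{⊗ n}` is concave (`entropyGap_concave_of_mutualInfo_le`). A concave
`F` of a product channel is subadditive (`entropyGap_tensor_le_of_concave`): let `π` be the product
of the marginals of `σ`, and `ρ_t = (1 - t) π + t σ`. All `ρ_t` have the same marginals, so by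
subadditivity of the entropy `S(B)` is largest at `t = 0`, whereas `S(E)` decreases by at most
`C t²` (`entropy_mix_product_ge`). Hence `t (F(σ) - F(π)) ≤ F(ρ_t) - F(π) ≤ C t²` for small `t`, so
`F(σ) ≤ F(π)`, and `F(π)` is the sum of the entropy differences of the factors. Splitting off one
factor at a time bounds `F` on `n` copies by `n Q⁽¹⁾(N)`.

The two entropy estimates come from comparing the eigenvalues of a state with a diagonal reference:
`entropy_le_of_diagonal` is Klein's inequality, and `le_entropy_of_diagonal` bounds the relative
entropy by the `χ²`-divergence, which is quadratic in `t`. Both admit singular states, provided that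
the support of the state lies in that of the reference; this holds for the product of marginals.
Invariance of the entropy under relabelling, transposition and passing from `K K†` to `K† K` follows
from its expression through the roots of the characteristic polynomial.
-/

noncomputable section

namespace QInfo

open Matrix Polynomial

/-! ### Entropy as a spectral quantity -/

section Spectral

variable {A B : Type} [Fintype A] [DecidableEq A] [Fintype B] [DecidableEq B]

/-- The sum of `-x log x` over the real parts of the roots of a polynomial, with multiplicity. The
entropy of a Hermitian matrix is this functional at its characteristic polynomial, so it can be
compared between matrices over different index types. -/
def rootEntropy (p : ℂ[X]) : ℝ :=
  (p.roots.map fun z => Real.negMulLog z.re).sum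

theorem rootEntropy_mul {p q : ℂ[X]} (hp : p ≠ 0) (hq : q ≠ 0) :
    rootEntropy (p * q) = rootEntropy p + rootEntropy q := by
  simp [rootEntropy, roots_mul (mul_ne_zero hp hq)]

theorem rootEntropy_X_pow (n : ℕ) : rootEntropy (X ^ n : ℂ[X]) = 0 := by
  simp [rootEntropy, Multiset.map_nsmul, Multiset.sum_nsmul]

theorem rootEntropy_prod {ι : Type} (s : Finset ι) (p : ι → ℂ[X]) (hp : ∀ i, p i ≠ 0) :
    rootEntropy (∏ i ∈ s, p i) = ∑ i ∈ s, rootEntropy (p i) := by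
  classical
  induction s using Finset.induction_on with
  | empty => simp [rootEntropy]
  | insert a s ha ih =>
    rw [Finset.prod_insert ha, Finset.sum_insert ha,
      rootEntropy_mul (hp a) (Finset.prod_ne_zero_iff.2 fun i _ => hp i), ih]

theorem entropy_eq_rootEntropy {ρ : Matrix A A ℂ} (h : ρ.IsHermitian) :
    vonNeumannEntropy ρ = rootEntropy ρ.charpoly := by
  have hcfc : ρ * cfc Real.log ρ = cfc (fun x => x * Real.log x) ρ := by
    -- the spectrum is finite, so every function is continuous on it
    have hcont (f : ℝ → ℝ) : ContinuousOn f (spectrum ℝ ρ) :=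
      (Matrix.finite_real_spectrum (A := ρ)).continuousOn f
    have hid : cfc (fun x : ℝ => x) ρ = ρ := cfc_id' ℝ ρ h.isSelfAdjoint
    rw [cfc_mul (fun x : ℝ => x) Real.log ρ (hcont _) (hcont _), hid]
  rw [vonNeumannEntropy, hcfc, h.cfc_eq, IsHermitian.cfc, Unitary.conjStarAlgAut_apply,
    trace_mul_comm, ← mul_assoc, Unitary.coe_star_mul_self, one_mul, rootEntropy,
    h.roots_charpoly_eq_eigenvalues]
  simp [trace, Real.negMulLog]

theorem entropy_eq_of_charpoly_eq {ρ : Matrix A A ℂ} {σ : Matrix B B ℂ} (hρ : ρ.IsHermitian)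
    (hσ : σ.IsHermitian) (h : ρ.charpoly = σ.charpoly) :
    vonNeumannEntropy ρ = vonNeumannEntropy σ := by
  rw [entropy_eq_rootEntropy hρ, entropy_eq_rootEntropy hσ, h]

theorem entropy_submatrix_equiv (e : B ≃ A) {ρ : Matrix A A ℂ} (h : ρ.IsHermitian) :
    vonNeumannEntropy (ρ.submatrix e e) = vonNeumannEntropy ρ :=
  entropy_eq_of_charpoly_eq (h.submatrix e) h (Matrix.charpoly_reindex e.symm ρ)

theorem entropy_transpose {ρ : Matrix A A ℂ} (h : ρ.IsHermitian) :
    vonNeumannEntropy ρᵀ = vonNeumannEntropy ρ :=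
  entropy_eq_of_charpoly_eq h.transpose h (Matrix.charpoly_transpose ρ)

/-- The two reduced states of a pure state have the same entropy. -/
theorem entropy_mul_conjTranspose_comm (K : Matrix A B ℂ) :
    vonNeumannEntropy (K * Kᴴ) = vonNeumannEntropy (Kᴴ * K) := by
  have h := congrArg rootEntropy (Matrix.charpoly_mul_comm' K Kᴴ)
  rw [rootEntropy_mul (pow_ne_zero _ X_ne_zero) (charpoly_monic _).ne_zero,
    rootEntropy_mul (pow_ne_zero _ X_ne_zero) (charpoly_monic _).ne_zero,
    rootEntropy_X_pow, rootEntropy_X_pow, zero_add, zero_add] at h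
  rw [entropy_eq_rootEntropy (isHermitian_mul_conjTranspose_self K),
    entropy_eq_rootEntropy (isHermitian_conjTranspose_mul_self K), h]

theorem entropy_unitary_conj {U : Matrix A A ℂ} (hU : Uᴴ * U = 1) {ρ : Matrix A A ℂ}
    (h : ρ.IsHermitian) : vonNeumannEntropy (U * ρ * Uᴴ) = vonNeumannEntropy ρ := by
  refine entropy_eq_of_charpoly_eq (isHermitian_mul_mul_conjTranspose U h) h ?_
  rw [Matrix.charpoly_mul_comm, ← mul_assoc, hU, one_mul]

theorem entropy_diagonal (w : A → ℝ) :
    vonNeumannEntropy (diagonal fun a => (w a : ℂ)) = ∑ a, Real.negMulLog (w a) := by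
  have h : (diagonal fun a => (w a : ℂ)).IsHermitian :=
    isHermitian_diagonal_of_self_adjoint _ (by ext; simp)
  rw [entropy_eq_rootEntropy h, charpoly_diagonal, rootEntropy_prod _ _ fun a => X_sub_C_ne_zero _]
  simp [rootEntropy]

theorem exists_unitary_diagonalization {ρ : Matrix A A ℂ} (h : ρ.PosSemidef) :
    ∃ (U : Matrix A A ℂ) (r : A → ℝ), Uᴴ * U = 1 ∧ (∀ i, 0 ≤ r i) ∧
      ρ = U * diagonal (fun i => (r i : ℂ)) * Uᴴ := by
  refine ⟨h.1.eigenvectorUnitary, h.1.eigenvalues, Unitary.coe_star_mul_self _,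
    h.eigenvalues_nonneg, ?_⟩
  conv_lhs => rw [h.1.spectral_theorem, Unitary.conjStarAlgAut_apply]
  rfl

/-- The spectral data of a positive matrix `ρ` seen from the standard basis: its eigenvalues `r i`
and the squared overlaps `p i j` of the `i`-th eigenvector with the `j`-th basis vector. -/
theorem exists_spectral_weights {ρ : Matrix A A ℂ} (h : ρ.PosSemidef) :
    ∃ (r : A → ℝ) (p : A → A → ℝ), (∀ i, 0 ≤ r i) ∧ (∀ i j, 0 ≤ p i j) ∧
      (∀ i, ∑ j, p i j = 1) ∧ (∀ j, ∑ i, p i j = 1) ∧ (∀ j, (ρ j j).re = ∑ i, p i j * r i) ∧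
      (∀ j, ((ρ * ρ) j j).re = ∑ i, p i j * r i ^ 2) ∧
      vonNeumannEntropy ρ = ∑ i, Real.negMulLog (r i) := by
  obtain ⟨U, r, hUU, hr, hspec⟩ := exists_unitary_diagonalization h
  have hUU' : U * Uᴴ = 1 := mul_eq_one_comm.1 hUU
  have hsq : ρ * ρ = U * diagonal (fun i => ((r i ^ 2 : ℝ) : ℂ)) * Uᴴ := by
    have : ρ * ρ = U * (diagonal (fun i => (r i : ℂ)) * (Uᴴ * U) *
        diagonal (fun i => (r i : ℂ))) * Uᴴ := by
      conv_lhs => rw [hspec]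
      simp only [mul_assoc]
    rw [this, hUU, mul_one, diagonal_mul_diagonal]
    simp [pow_two]
  have hdiag (w : A → ℝ) (j : A) :
      ((U * diagonal (fun i => (w i : ℂ)) * Uᴴ) j j).re = ∑ i, Complex.normSq (U j i) * w i := by
    rw [mul_apply, Complex.re_sum]
    refine Finset.sum_congr rfl fun i _ => ?_
    rw [mul_diagonal, conjTranspose_apply, mul_right_comm, RCLike.star_def, Complex.mul_conj]
    simp
  refine ⟨r, fun i j => Complex.normSq (U j i), hr,
    fun _ _ => Complex.normSq_nonneg _, fun i => ?_, fun j => ?_, fun j => ?_,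
    fun j => ?_, ?_⟩
  · have := congrArg (fun M : Matrix A A ℂ => (M i i).re) hUU
    simp only [mul_apply, conjTranspose_apply, RCLike.star_def, one_apply_eq, Complex.one_re,
      Complex.re_sum] at this
    rw [← this]
    refine Finset.sum_congr rfl fun j _ => ?_
    rw [mul_comm, Complex.mul_conj]
    simp
  · have := congrArg (fun M : Matrix A A ℂ => (M j j).re) hUU'
    simp only [mul_apply, conjTranspose_apply, RCLike.star_def, one_apply_eq, Complex.one_re,
      Complex.re_sum] at this
    rw [← this]
    refine Finset.sum_congr rfl fun i _ => ?_
    rw [Complex.mul_conj, Complex.ofReal_re]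
  · rw [← hdiag, ← hspec]
  · rw [← hdiag, ← hsq]
  · conv_lhs => rw [hspec]
    rw [entropy_unitary_conj hUU (isHermitian_diagonal_of_self_adjoint _ (by ext; simp)),
      entropy_diagonal]

theorem trace_re_eq_sum {A : Type} [Fintype A] (ρ : Matrix A A ℂ) :
    ρ.trace.re = ∑ j, (ρ j j).re := by
  simp [trace]

theorem entropy_nonneg {ρ : Matrix A A ℂ} (h : IsState ρ) : 0 ≤ vonNeumannEntropy ρ := by
  obtain ⟨r, p, hr, hp, hp1, -, hd, -, hS⟩ := exists_spectral_weights h.1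
  have hsum : ∑ i, r i = 1 := by
    have := trace_re_eq_sum ρ
    rw [h.2, Finset.sum_congr rfl fun j _ => hd j, Finset.sum_comm] at this
    simpa [← Finset.sum_mul, hp1] using this.symm
  rw [hS]
  exact Finset.sum_nonneg fun i _ => Real.negMulLog_nonneg (hr i) <|
    hsum ▸ Finset.single_le_sum (fun j _ => hr j) (Finset.mem_univ i)

theorem entropy_le_card {ρ : Matrix A A ℂ} (h : IsState ρ) :
    vonNeumannEntropy ρ ≤ Fintype.card A := by
  obtain ⟨r, p, hr, -, -, -, -, -, hS⟩ := exists_spectral_weights h.1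
  have hle : ∀ i ∈ Finset.univ, Real.negMulLog (r i) ≤ 1 := fun i _ => by
    rcases (hr i).eq_or_lt with h0 | h0
    · simp [← h0]
    · have := Real.one_sub_inv_le_log_of_pos h0
      have h2 := mul_le_mul_of_nonneg_left this (hr i)
      rw [mul_sub, mul_inv_cancel₀ h0.ne'] at h2
      rw [Real.negMulLog]
      linarith
  rw [hS]
  simpa using Finset.sum_le_sum hle

/-- Klein's inequality against a diagonal reference `z` with `supp ρ ⊆ supp z`. -/
theorem entropy_le_of_diagonal {ρ : Matrix A A ℂ} (h : ρ.PosSemidef) {z : A → ℝ}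
    (hz : ∀ j, 0 ≤ z j) (hsupp : ∀ j, z j = 0 → (ρ j j).re = 0) :
    vonNeumannEntropy ρ ≤ ∑ j, (ρ j j).re * (-Real.log (z j)) + ∑ j, z j - ρ.trace.re := by
  obtain ⟨r, p, hr, hp, hp1, hpc, hd, -, hS⟩ := exists_spectral_weights h
  -- where `z` vanishes all terms vanish, so the values `log 0 = 0` and `x / 0 = 0` do no harm
  have hzero (i j : A) (hj : z j = 0) : p i j * r i = 0 := by
    have := hsupp j hj
    rw [hd, Finset.sum_eq_zero_iff_of_nonneg fun i _ => mul_nonneg (hp i j) (hr i)] at this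
    exact this i (Finset.mem_univ i)
  have hS' : vonNeumannEntropy ρ = ∑ j, ∑ i, p i j * Real.negMulLog (r i) := by
    rw [hS, Finset.sum_comm]
    simp [← Finset.sum_mul, hp1]
  rw [hS', trace_re_eq_sum, ← Finset.sum_add_distrib, ← Finset.sum_sub_distrib]
  refine Finset.sum_le_sum fun j _ => ?_
  have hzj : z j = ∑ i, p i j * z j := by rw [← Finset.sum_mul, hpc, one_mul]
  rw [hd, Finset.sum_mul]
  nth_rewrite 2 [hzj]
  rw [← Finset.sum_add_distrib, ← Finset.sum_sub_distrib]
  refine Finset.sum_le_sum fun i _ => ?_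
  rcases (hz j).eq_or_lt with hj | hj
  · rw [Real.negMulLog, ← hj]
    have := hzero i j hj.symm
    have h2 : p i j * (-r i * Real.log (r i)) = -(p i j * r i) * Real.log (r i) := by ring
    rw [h2, this]
    simp
  rcases (hr i).eq_or_lt with hi | hi
  · simpa [← hi] using mul_nonneg (hp i j) hj.le
  -- `log x ≤ x - 1` at `x = z j / r i`
  have hlog := Real.log_le_sub_one_of_pos (div_pos hj hi)
  rw [Real.log_div hj.ne' hi.ne'] at hlog
  have := mul_le_mul_of_nonneg_left hlog (mul_nonneg (hp i j) hi.le)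
  have h2 : p i j * r i * (z j / r i - 1) = p i j * z j - p i j * r i := by
    field_simp
  rw [h2] at this
  rw [Real.negMulLog]
  linarith

/-- The upper bound of relative entropy by the `χ²`-divergence, for a diagonal reference `z` with
`supp ρ ⊆ supp z`. -/
theorem le_entropy_of_diagonal {ρ : Matrix A A ℂ} (h : ρ.PosSemidef) {z : A → ℝ}
    (hz : ∀ j, 0 ≤ z j) (hsupp : ∀ j, z j = 0 → (ρ j j).re = 0) :
    ∑ j, (ρ j j).re * (-Real.log (z j)) - (∑ j, ((ρ * ρ) j j).re / z j - ρ.trace.re) ≤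
      vonNeumannEntropy ρ := by
  obtain ⟨r, p, hr, hp, hp1, -, hd, hd2, hS⟩ := exists_spectral_weights h
  -- where `z` vanishes all terms vanish, so the values `log 0 = 0` and `x / 0 = 0` do no harm
  have hzero (i j : A) (hj : z j = 0) : p i j * r i = 0 := by
    have := hsupp j hj
    rw [hd, Finset.sum_eq_zero_iff_of_nonneg fun i _ => mul_nonneg (hp i j) (hr i)] at this
    exact this i (Finset.mem_univ i)
  have hS' : vonNeumannEntropy ρ = ∑ j, ∑ i, p i j * Real.negMulLog (r i) := by
    rw [hS, Finset.sum_comm]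
    simp [← Finset.sum_mul, hp1]
  rw [hS', trace_re_eq_sum, ← Finset.sum_sub_distrib, ← Finset.sum_sub_distrib]
  refine Finset.sum_le_sum fun j _ => ?_
  rw [hd, hd2, Finset.sum_mul, Finset.sum_div, ← Finset.sum_sub_distrib, ← Finset.sum_sub_distrib]
  refine Finset.sum_le_sum fun i _ => ?_
  rcases (hz j).eq_or_lt with hj | hj
  · rw [Real.negMulLog, ← hj]
    have := hzero i j hj.symm
    have h2 : p i j * (-r i * Real.log (r i)) = -(p i j * r i) * Real.log (r i) := by ring
    rw [h2, this]
    simp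
  rcases (hr i).eq_or_lt with hi | hi
  · simp [← hi]
  -- `log x ≤ x - 1` at `x = r i / z j`
  have hlog := Real.log_le_sub_one_of_pos (div_pos hi hj)
  rw [Real.log_div hi.ne' hj.ne'] at hlog
  have := mul_le_mul_of_nonneg_left hlog (mul_nonneg (hp i j) hi.le)
  have h2 : p i j * r i * (r i / z j - 1) = p i j * r i ^ 2 / z j - p i j * r i := by ring
  rw [h2] at this
  rw [Real.negMulLog]
  linarith

end Spectral

/-! ### Partial traces and mixtures -/

section PartialTrace

variable {A B : Type} [Fintype A] [DecidableEq A] [Fintype B] [DecidableEq B]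

/-- An additive property of operators on `H_A ⊗ H_B` need only be checked on `X ⊗ Y`. -/
theorem kronecker_induction {p : Matrix (A × B) (A × B) ℂ → Prop}
    (kron : ∀ (X : Matrix A A ℂ) (Y : Matrix B B ℂ), p (X ⊗ₖ Y))
    (add : ∀ X Y, p X → p Y → p (X + Y)) (X : Matrix (A × B) (A × B) ℂ) : p X := by
  have h0 : p 0 := by simpa using kron 0 0
  have hsum {ι : Type} (s : Finset ι) (f : ι → Matrix (A × B) (A × B) ℂ)
      (h : ∀ i ∈ s, p (f i)) : p (∑ i ∈ s, f i) := Finset.sum_induction f p add h0 h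
  rw [Matrix.matrix_eq_sum_single X]
  refine hsum _ _ fun i _ => hsum _ _ fun j _ => ?_
  have : single i j (X i j) = single i.1 j.1 (X i j) ⊗ₖ single i.2 j.2 (1 : ℂ) := by
    rw [single_kronecker_single]
    simp
  rw [this]
  exact kron _ _

theorem ptraceRight_add {A B : Type} [Fintype B] (X Y : Matrix (A × B) (A × B) ℂ) :
    ptraceRight (X + Y) = ptraceRight X + ptraceRight Y := by
  ext; simp [ptraceRight, Finset.sum_add_distrib]

theorem ptraceLeft_add {A B : Type} [Fintype A] (X Y : Matrix (A × B) (A × B) ℂ) :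
    ptraceLeft (X + Y) = ptraceLeft X + ptraceLeft Y := by
  ext; simp [ptraceLeft, Finset.sum_add_distrib]

theorem ptraceRight_smul {A B : Type} [Fintype B] (c : ℂ) (X : Matrix (A × B) (A × B) ℂ) :
    ptraceRight (c • X) = c • ptraceRight X := by
  ext; simp [ptraceRight, Finset.mul_sum]

theorem ptraceLeft_smul {A B : Type} [Fintype A] (c : ℂ) (X : Matrix (A × B) (A × B) ℂ) :
    ptraceLeft (c • X) = c • ptraceLeft X := by
  ext; simp [ptraceLeft, Finset.mul_sum]

theorem ptraceRight_kronecker {A B : Type} [Fintype B] (X : Matrix A A ℂ) (Y : Matrix B B ℂ) :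
    ptraceRight (X ⊗ₖ Y) = Y.trace • X := by
  ext a b
  simp [ptraceRight, trace, ← Finset.mul_sum, mul_comm]

theorem ptraceLeft_kronecker {A B : Type} [Fintype A] (X : Matrix A A ℂ) (Y : Matrix B B ℂ) :
    ptraceLeft (X ⊗ₖ Y) = X.trace • Y := by
  ext a b
  simp [ptraceLeft, trace, ← Finset.sum_mul]

theorem trace_ptraceRight {A B : Type} [Fintype A] [Fintype B] (X : Matrix (A × B) (A × B) ℂ) :
    (ptraceRight X).trace = X.trace := by
  simp [ptraceRight, trace, Fintype.sum_prod_type]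

theorem trace_ptraceLeft {A B : Type} [Fintype A] [Fintype B] (X : Matrix (A × B) (A × B) ℂ) :
    (ptraceLeft X).trace = X.trace := by
  simp [ptraceLeft, trace, Fintype.sum_prod_type_right]

theorem posSemidef_ptraceRight {A B : Type} [Fintype A] [Fintype B]
    {X : Matrix (A × B) (A × B) ℂ} (h : X.PosSemidef) : (ptraceRight X).PosSemidef := by
  have : ptraceRight X = ∑ b, X.submatrix (fun a => (a, b)) (fun a => (a, b)) := by
    ext; simp [ptraceRight, Matrix.sum_apply]
  rw [this]
  exact posSemidef_sum _ fun b _ => h.submatrix _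

theorem posSemidef_ptraceLeft {A B : Type} [Fintype A] [Fintype B]
    {X : Matrix (A × B) (A × B) ℂ} (h : X.PosSemidef) : (ptraceLeft X).PosSemidef := by
  have : ptraceLeft X = ∑ a, X.submatrix (fun b => (a, b)) (fun b => (a, b)) := by
    ext; simp [ptraceLeft, Matrix.sum_apply]
  rw [this]
  exact posSemidef_sum _ fun b _ => h.submatrix _

theorem IsState.ptraceRight {A B : Type} [Fintype A] [Fintype B]
    {X : Matrix (A × B) (A × B) ℂ} (h : IsState X) : IsState (ptraceRight X) :=
  ⟨posSemidef_ptraceRight h.1, by rw [trace_ptraceRight, h.2]⟩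

theorem IsState.ptraceLeft {A B : Type} [Fintype A] [Fintype B]
    {X : Matrix (A × B) (A × B) ℂ} (h : IsState X) : IsState (ptraceLeft X) :=
  ⟨posSemidef_ptraceLeft h.1, by rw [trace_ptraceLeft, h.2]⟩

theorem IsState.kronecker {A B : Type} [Fintype A] [Fintype B] {X : Matrix A A ℂ}
    {Y : Matrix B B ℂ} (hX : IsState X) (hY : IsState Y) : IsState (X ⊗ₖ Y) :=
  ⟨hX.1.kronecker hY.1, by rw [trace_kronecker, hX.2, hY.2, mul_one]⟩

theorem IsState.submatrix_equiv {A B : Type} [Fintype A] [Fintype B] {X : Matrix A A ℂ}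
    (hX : IsState X) (e : B ≃ A) : IsState (X.submatrix e e) :=
  ⟨hX.1.submatrix e, by rw [← hX.2]; exact Fintype.sum_equiv e _ _ fun _ => rfl⟩

theorem IsState.isHermitian {A : Type} [Fintype A] {X : Matrix A A ℂ} (hX : IsState X) :
    X.IsHermitian := hX.1.1

theorem IsState.conj {U X : Matrix A A ℂ} (hX : IsState X) (hU : Uᴴ * U = 1) :
    IsState (U * X * Uᴴ) :=
  ⟨hX.1.mul_mul_conjTranspose_same U, by rw [trace_mul_comm, ← mul_assoc, hU, one_mul, hX.2]⟩

/-- The mixture `(1 - t) ρ + t σ`. -/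
def mix {A : Type} (t : ℝ) (ρ σ : Matrix A A ℂ) : Matrix A A ℂ :=
  ((1 - t : ℝ) : ℂ) • ρ + (t : ℂ) • σ

theorem IsState.mix {A : Type} [Fintype A] {ρ σ : Matrix A A ℂ} (hρ : IsState ρ)
    (hσ : IsState σ) {t : ℝ} (h0 : 0 ≤ t) (h1 : t ≤ 1) : IsState (mix t ρ σ) := by
  refine ⟨.add (hρ.1.smul ?_) (hσ.1.smul ?_), ?_⟩
  · exact_mod_cast sub_nonneg.2 h1
  · exact_mod_cast h0
  · simp [QInfo.mix, hρ.2, hσ.2]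

theorem map_mix {A B : Type} (Φ : Superop A B) (t : ℝ) (ρ σ : Matrix A A ℂ) :
    Φ (mix t ρ σ) = mix t (Φ ρ) (Φ σ) := by
  simp only [mix, map_add, map_smul]

theorem mix_self {A : Type} (t : ℝ) (ρ : Matrix A A ℂ) : mix t ρ ρ = ρ := by
  rw [mix, ← add_smul]
  simp

theorem ptraceRight_mix {A B : Type} [Fintype B] (t : ℝ) (ρ σ : Matrix (A × B) (A × B) ℂ) :
    ptraceRight (mix t ρ σ) = mix t (ptraceRight ρ) (ptraceRight σ) := by
  simp only [mix, ptraceRight_add, ptraceRight_smul]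

theorem ptraceLeft_mix {A B : Type} [Fintype A] (t : ℝ) (ρ σ : Matrix (A × B) (A × B) ℂ) :
    ptraceLeft (mix t ρ σ) = mix t (ptraceLeft ρ) (ptraceLeft σ) := by
  simp only [mix, ptraceLeft_add, ptraceLeft_smul]

theorem ptraceRight_conj_kronecker {U : Matrix A A ℂ} {V : Matrix B B ℂ} (hV : Vᴴ * V = 1)
    (X : Matrix (A × B) (A × B) ℂ) :
    ptraceRight ((U ⊗ₖ V) * X * (U ⊗ₖ V)ᴴ) = U * ptraceRight X * Uᴴ := by
  induction X using kronecker_induction with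
  | kron X Y =>
    rw [conjTranspose_kronecker, ← mul_kronecker_mul, ← mul_kronecker_mul, ptraceRight_kronecker,
      ptraceRight_kronecker, trace_mul_comm, ← mul_assoc, hV, one_mul]
    simp
  | add X Y hX hY => simp only [mul_add, add_mul, ptraceRight_add, hX, hY]

theorem ptraceLeft_conj_kronecker {U : Matrix A A ℂ} {V : Matrix B B ℂ} (hU : Uᴴ * U = 1)
    (X : Matrix (A × B) (A × B) ℂ) :
    ptraceLeft ((U ⊗ₖ V) * X * (U ⊗ₖ V)ᴴ) = V * ptraceLeft X * Vᴴ := by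
  induction X using kronecker_induction with
  | kron X Y =>
    rw [conjTranspose_kronecker, ← mul_kronecker_mul, ← mul_kronecker_mul, ptraceLeft_kronecker,
      ptraceLeft_kronecker, trace_mul_comm, ← mul_assoc, hU, one_mul]
    simp
  | add X Y hX hY => simp only [mul_add, add_mul, ptraceLeft_add, hX, hY]

end PartialTrace

/-! ### Entropy of bipartite states -/

section Bipartite

variable {A B : Type} [Fintype A] [DecidableEq A] [Fintype B] [DecidableEq B]

/-- A distribution vanishes wherever the product of its marginals does. -/
theorem marginal_product_support {A B : Type} [Fintype A] [Fintype B]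
    {d : A × B → ℝ} {w : A → ℝ} {v : B → ℝ}
    (hd : ∀ x, 0 ≤ d x) (hw : ∀ a, ∑ b, d (a, b) = w a) (hv : ∀ b, ∑ a, d (a, b) = v b)
    (x : A × B) (hx : w x.1 * v x.2 = 0) : d x = 0 := by
  rcases mul_eq_zero.1 hx with h | h
  · rw [← hw, Finset.sum_eq_zero_iff_of_nonneg fun b _ => hd _] at h
    exact h x.2 (Finset.mem_univ _)
  · rw [← hv, Finset.sum_eq_zero_iff_of_nonneg fun b _ => hd _] at h
    exact h x.1 (Finset.mem_univ _)

/-- The cross entropy of a distribution relative to the product of its marginals is the sum of the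
marginal entropies. -/
theorem sum_neg_log_marginal_product {A B : Type} [Fintype A] [Fintype B]
    {d : A × B → ℝ} {w : A → ℝ} {v : B → ℝ}
    (hd : ∀ x, 0 ≤ d x) (hw : ∀ a, ∑ b, d (a, b) = w a) (hv : ∀ b, ∑ a, d (a, b) = v b) :
    ∑ x, d x * (-Real.log (w x.1 * v x.2)) =
      ∑ a, Real.negMulLog (w a) + ∑ b, Real.negMulLog (v b) := by
  have h1 (x : A × B) : d x * (-Real.log (w x.1 * v x.2)) =
      d x * (-Real.log (w x.1)) + d x * (-Real.log (v x.2)) := by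
    by_cases hx : w x.1 * v x.2 = 0
    · simp [marginal_product_support hd hw hv x hx]
    · rw [Real.log_mul (left_ne_zero_of_mul hx) (right_ne_zero_of_mul hx)]
      ring
  rw [Finset.sum_congr rfl fun x _ => h1 x, Finset.sum_add_distrib]
  congr 1
  · rw [Fintype.sum_prod_type]
    refine Finset.sum_congr rfl fun a _ => ?_
    dsimp only
    rw [← Finset.sum_mul, hw, Real.negMulLog]
    ring
  · rw [Fintype.sum_prod_type_right]
    refine Finset.sum_congr rfl fun b _ => ?_
    dsimp only
    rw [← Finset.sum_mul, hv, Real.negMulLog]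
    ring

theorem sum_re_of_ptraceRight_eq_diagonal {A B : Type} [DecidableEq A] [Fintype B]
    {τ : Matrix (A × B) (A × B) ℂ} {w : A → ℝ}
    (h : ptraceRight τ = diagonal fun a => (w a : ℂ)) (a : A) :
    ∑ b, (τ (a, b) (a, b)).re = w a := by
  simpa [ptraceRight] using congrArg (fun M : Matrix A A ℂ => (M a a).re) h

theorem sum_re_of_ptraceLeft_eq_diagonal {A B : Type} [Fintype A] [DecidableEq B]
    {τ : Matrix (A × B) (A × B) ℂ} {v : B → ℝ}
    (h : ptraceLeft τ = diagonal fun b => (v b : ℂ)) (b : B) :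
    ∑ a, (τ (a, b) (a, b)).re = v b := by
  simpa [ptraceLeft] using congrArg (fun M : Matrix B B ℂ => (M b b).re) h

theorem diag_re_nonneg {A : Type} [Fintype A] {τ : Matrix A A ℂ} (h : τ.PosSemidef) (a : A) :
    0 ≤ (τ a a).re := (Complex.le_def.1 (h.diag_nonneg (i := a))).1

/-- Local unitaries bring both marginals of a bipartite state to diagonal form. -/
theorem exists_local_diagonalization {τ : Matrix (A × B) (A × B) ℂ} (h : IsState τ) :
    ∃ (U : Matrix A A ℂ) (V : Matrix B B ℂ) (w : A → ℝ) (v : B → ℝ),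
      Uᴴ * U = 1 ∧ Vᴴ * V = 1 ∧
      U * ptraceRight τ * Uᴴ = diagonal (fun a => (w a : ℂ)) ∧
      V * ptraceLeft τ * Vᴴ = diagonal (fun b => (v b : ℂ)) := by
  obtain ⟨U, w, hU, -, hw⟩ := exists_unitary_diagonalization h.ptraceRight.1
  obtain ⟨V, v, hV, -, hv⟩ := exists_unitary_diagonalization h.ptraceLeft.1
  refine ⟨Uᴴ, Vᴴ, w, v, ?_, ?_, ?_, ?_⟩
  · rw [conjTranspose_conjTranspose]; exact mul_eq_one_comm.1 hU
  · rw [conjTranspose_conjTranspose]; exact mul_eq_one_comm.1 hV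
  · rw [hw, conjTranspose_conjTranspose, mul_assoc, mul_assoc, hU, mul_one, ← mul_assoc, hU,
      one_mul]
  · rw [hv, conjTranspose_conjTranspose, mul_assoc, mul_assoc, hV, mul_one, ← mul_assoc, hV,
      one_mul]

theorem kronecker_isometry {U : Matrix A A ℂ} {V : Matrix B B ℂ} (hU : Uᴴ * U = 1)
    (hV : Vᴴ * V = 1) : (U ⊗ₖ V)ᴴ * (U ⊗ₖ V) = 1 := by
  rw [conjTranspose_kronecker, ← mul_kronecker_mul, hU, hV, one_kronecker_one]

theorem sum_eq_one_of_diagonal {w : A → ℝ} (h : IsState (diagonal fun a => (w a : ℂ))) :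
    ∑ a, w a = 1 := by
  have := h.2
  rw [trace_diagonal] at this
  exact_mod_cast this

theorem nonneg_of_diagonal {w : A → ℝ} (h : IsState (diagonal fun a => (w a : ℂ))) (a : A) :
    0 ≤ w a := by
  simpa using diag_re_nonneg h.1 a

theorem entropy_subadditive {τ : Matrix (A × B) (A × B) ℂ} (h : IsState τ) :
    vonNeumannEntropy τ ≤
      vonNeumannEntropy (ptraceRight τ) + vonNeumannEntropy (ptraceLeft τ) := by
  obtain ⟨U, V, w, v, hU, hV, hw, hv⟩ := exists_local_diagonalization h
  have hK := kronecker_isometry hU hV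
  have hst := h.conj hK
  have hR := ptraceRight_conj_kronecker (U := U) hV τ
  have hL := ptraceLeft_conj_kronecker (V := V) hU τ
  rw [hw] at hR
  rw [hv] at hL
  rw [← entropy_unitary_conj hK h.isHermitian, ← entropy_unitary_conj hU h.ptraceRight.isHermitian,
    ← entropy_unitary_conj hV h.ptraceLeft.isHermitian, hw, hv, entropy_diagonal, entropy_diagonal]
  generalize (U ⊗ₖ V) * τ * (U ⊗ₖ V)ᴴ = τ' at hst hR hL
  have hw' := hR ▸ hst.ptraceRight
  have hv' := hL ▸ hst.ptraceLeft
  have hd1 := sum_re_of_ptraceRight_eq_diagonal hR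
  have hd2 := sum_re_of_ptraceLeft_eq_diagonal hL
  have hd0 := diag_re_nonneg hst.1
  have hz1 : ∑ x : A × B, w x.1 * v x.2 = 1 := by
    rw [Fintype.sum_prod_type, ← Finset.sum_mul_sum, sum_eq_one_of_diagonal hw',
      sum_eq_one_of_diagonal hv', one_mul]
  have := entropy_le_of_diagonal hst.1 (z := fun x => w x.1 * v x.2)
    (fun x => mul_nonneg (nonneg_of_diagonal hw' _) (nonneg_of_diagonal hv' _))
    (marginal_product_support (d := fun x => (τ' x x).re) hd0 hd1 hd2)
  rw [sum_neg_log_marginal_product (d := fun x => (τ' x x).re) hd0 hd1 hd2, hz1, hst.2,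
    Complex.one_re] at this
  linarith

/-- Near the product of its marginals the mutual information of a state vanishes to second order
along the segment towards the state. -/
theorem entropy_mix_product_ge {τ : Matrix (A × B) (A × B) ℂ} (h : IsState τ) :
    ∃ C : ℝ, ∀ t : ℝ, 0 ≤ t → t ≤ 1 →
      vonNeumannEntropy (ptraceRight τ) + vonNeumannEntropy (ptraceLeft τ) - C * t ^ 2 ≤
        vonNeumannEntropy (mix t (ptraceRight τ ⊗ₖ ptraceLeft τ) τ) := by
  obtain ⟨U, V, w, v, hU, hV, hw, hv⟩ := exists_local_diagonalization h
  have hK := kronecker_isometry hU hV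
  have hst := h.conj hK
  have hR := ptraceRight_conj_kronecker (U := U) hV τ
  have hL := ptraceLeft_conj_kronecker (V := V) hU τ
  have hprod : (U ⊗ₖ V) * (ptraceRight τ ⊗ₖ ptraceLeft τ) * (U ⊗ₖ V)ᴴ =
      diagonal fun x => ((w x.1 * v x.2 : ℝ) : ℂ) := by
    rw [conjTranspose_kronecker, ← mul_kronecker_mul, ← mul_kronecker_mul, hw, hv,
      diagonal_kronecker_diagonal]
    simp
  have hmix (t : ℝ) : (U ⊗ₖ V) * mix t (ptraceRight τ ⊗ₖ ptraceLeft τ) τ * (U ⊗ₖ V)ᴴ =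
      mix t (diagonal fun x => ((w x.1 * v x.2 : ℝ) : ℂ)) ((U ⊗ₖ V) * τ * (U ⊗ₖ V)ᴴ) := by
    simp only [mix, mul_add, add_mul, mul_smul_comm, smul_mul_assoc, hprod]
  have hent (t : ℝ) (h0 : 0 ≤ t) (h1 : t ≤ 1) :
      vonNeumannEntropy (mix t (ptraceRight τ ⊗ₖ ptraceLeft τ) τ) = vonNeumannEntropy
        (mix t (diagonal fun x => ((w x.1 * v x.2 : ℝ) : ℂ)) ((U ⊗ₖ V) * τ * (U ⊗ₖ V)ᴴ)) := by
    rw [← hmix, entropy_unitary_conj hK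
      ((h.ptraceRight.kronecker h.ptraceLeft).mix h h0 h1).isHermitian]
  have hZ : IsState (diagonal fun x : A × B => ((w x.1 * v x.2 : ℝ) : ℂ)) :=
    hprod ▸ (h.ptraceRight.kronecker h.ptraceLeft).conj hK
  rw [hw] at hR
  rw [hv] at hL
  rw [← entropy_unitary_conj hU h.ptraceRight.isHermitian,
    ← entropy_unitary_conj hV h.ptraceLeft.isHermitian, hw, hv, entropy_diagonal, entropy_diagonal]
  generalize (U ⊗ₖ V) * τ * (U ⊗ₖ V)ᴴ = τ' at hst hR hL hent
  have hw' := hR ▸ hst.ptraceRight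
  have hv' := hL ▸ hst.ptraceLeft
  have hd1 := sum_re_of_ptraceRight_eq_diagonal hR
  have hd2 := sum_re_of_ptraceLeft_eq_diagonal hL
  have hd0 := diag_re_nonneg hst.1
  have hz1 := sum_eq_one_of_diagonal hZ
  set z : A × B → ℝ := fun x => w x.1 * v x.2 with hz
  set Z : Matrix (A × B) (A × B) ℂ := diagonal fun x => (z x : ℂ) with hZdef
  have hz0 : ∀ x, 0 ≤ z x := nonneg_of_diagonal hZ
  have hsupp := marginal_product_support (d := fun x => (τ' x x).re) hd0 hd1 hd2
  set D := τ' - Z with hD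
  have hDre (x : A × B) : (D x x).re = (τ' x x).re - z x := by simp [hD, hZdef]
  have hDsum : ∑ x, (D x x).re = 0 := by
    rw [Finset.sum_congr rfl fun x _ => hDre x, Finset.sum_sub_distrib, hz1, ← trace_re_eq_sum,
      hst.2, Complex.one_re, sub_self]
  -- the state at `t` is `Z + t D` with `D` traceless, so its `χ²`-divergence from `Z` has no
  -- constant and no linear term in `t`; this is the coefficient of `t ^ 2`
  refine ⟨∑ x, ((D * D) x x).re / z x, fun t h0 h1 => ?_⟩
  rw [hent t h0 h1]
  have hmst := hZ.mix hst h0 h1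
  have hmixD : mix t Z τ' = Z + (t : ℂ) • D := by
    rw [mix, hD, Complex.ofReal_sub, Complex.ofReal_one, sub_smul, one_smul, smul_sub]
    abel
  have hmre (x : A × B) : (mix t Z τ' x x).re = (1 - t) * z x + t * (τ' x x).re := by
    rw [hmixD]
    simp [hZdef, hD]
    ring
  have hm1 (a : A) : ∑ b, (mix t Z τ' (a, b) (a, b)).re = w a := by
    simp only [hmre, Finset.sum_add_distrib, ← Finset.mul_sum, hd1, hz]
    rw [sum_eq_one_of_diagonal hv']
    ring
  have hm2 (b : B) : ∑ a, (mix t Z τ' (a, b) (a, b)).re = v b := by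
    simp only [hmre, Finset.sum_add_distrib, ← Finset.mul_sum, ← Finset.sum_mul, hd2, hz]
    rw [sum_eq_one_of_diagonal hw']
    ring
  have hsq (x : A × B) : ((mix t Z τ' * mix t Z τ') x x).re / z x =
      z x + 2 * t * (D x x).re + t ^ 2 * (((D * D) x x).re / z x) := by
    have h1 : ((mix t Z τ' * mix t Z τ') x x).re =
        z x * z x + 2 * t * (z x * (D x x).re) + t ^ 2 * ((D * D) x x).re := by
      rw [hmixD, add_mul, mul_add, mul_add, mul_smul_comm, smul_mul_assoc, smul_mul_smul]
      simp [hZdef, -diagonal_mul_diagonal, diagonal_mul, mul_diagonal, ← Complex.ofReal_mul]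
      ring
    rw [h1]
    by_cases hx : z x = 0
    · have h0 : (D x x).re = 0 := by rw [hDre, hx, sub_zero]; exact hsupp x hx
      simp [h0, hx]
    · field_simp
  have hsqsum : ∑ x, ((mix t Z τ' * mix t Z τ') x x).re / z x =
      1 + (∑ x, ((D * D) x x).re / z x) * t ^ 2 := by
    rw [Finset.sum_congr rfl fun x _ => hsq x, Finset.sum_add_distrib, Finset.sum_add_distrib,
      ← Finset.mul_sum, ← Finset.mul_sum, hDsum, hz1]
    ring
  have key := le_entropy_of_diagonal hmst.1 hz0
    (marginal_product_support (d := fun x => (mix t Z τ' x x).re) (diag_re_nonneg hmst.1) hm1 hm2)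
  rw [sum_neg_log_marginal_product (d := fun x => (mix t Z τ' x x).re) (diag_re_nonneg hmst.1)
    hm1 hm2, hsqsum, hmst.2, Complex.one_re] at key
  linarith

theorem entropy_kronecker {ρ : Matrix A A ℂ} {σ : Matrix B B ℂ} (hρ : IsState ρ)
    (hσ : IsState σ) :
    vonNeumannEntropy (ρ ⊗ₖ σ) = vonNeumannEntropy ρ + vonNeumannEntropy σ := by
  have h := hρ.kronecker hσ
  have hR : ptraceRight (ρ ⊗ₖ σ) = ρ := by rw [ptraceRight_kronecker, hσ.2, one_smul]
  have hL : ptraceLeft (ρ ⊗ₖ σ) = σ := by rw [ptraceLeft_kronecker, hρ.2, one_smul]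
  have hle := entropy_subadditive h
  obtain ⟨C, hC⟩ := entropy_mix_product_ge h
  have hge := hC 0 le_rfl zero_le_one
  rw [hR, hL] at hle hge
  rw [mix_self] at hge
  linarith

end Bipartite

/-! ### Tensor products of super-operators -/

section Superoperators

variable {A B A' B' V : Type} [Fintype A] [DecidableEq A] [Fintype A'] [DecidableEq A']
  [Fintype V] [DecidableEq V]

theorem tensor_id_comp_tensor_id {C : Type} [Fintype C] [DecidableEq C] (Ψ : Superop A C)
    (Φ : Superop A' B') (X : Matrix (A × A') (A × A') ℂ) :
    tensor (LinearMap.id : Superop C C) Φ (tensor Ψ (LinearMap.id : Superop A' A') X) =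
      tensor Ψ Φ X := by
  induction X using kronecker_induction with
  | kron X Y => simp only [tensor_kronecker, LinearMap.id_apply]
  | add X Y hX hY => simp only [map_add, hX, hY]

theorem tensor_assoc {C D : Type} (Θ : Superop V D) (Φ : Superop A B)
    (Ψ : Superop A' C) (X : Matrix (V × A × A') (V × A × A') ℂ) :
    tensor Θ (tensor Φ Ψ) X =
      (tensor (tensor Θ Φ) Ψ (X.submatrix (Equiv.prodAssoc V A A') (Equiv.prodAssoc V A A'))
        ).submatrix (Equiv.prodAssoc D B C).symm (Equiv.prodAssoc D B C).symm := by
  induction X using kronecker_induction with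
  | kron X Y =>
    induction Y using kronecker_induction with
    | kron Y Z =>
      have h : (X ⊗ₖ (Y ⊗ₖ Z)).submatrix (Equiv.prodAssoc V A A') (Equiv.prodAssoc V A A') =
          (X ⊗ₖ Y) ⊗ₖ Z := by ext; simp [mul_assoc]
      rw [h]
      simp only [tensor_kronecker]
      ext
      simp [mul_assoc]
    | add Y Z hY hZ =>
      simp only [kronecker_add, map_add, hY, hZ, submatrix_add, Pi.add_apply]
  | add X Y hX hY => simp only [map_add, hX, hY, submatrix_add, Pi.add_apply]

theorem tensor_swap (Φ : Superop A B) (Ψ : Superop A' B')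
    (X : Matrix (A × A') (A × A') ℂ) :
    tensor Φ Ψ X =
      (tensor Ψ Φ (X.submatrix Prod.swap Prod.swap)).submatrix Prod.swap Prod.swap := by
  induction X using kronecker_induction with
  | kron X Y =>
    have h : (X ⊗ₖ Y).submatrix Prod.swap Prod.swap = Y ⊗ₖ X := by ext; simp [mul_comm]
    rw [h]
    simp only [tensor_kronecker]
    ext
    simp [mul_comm]
  | add X Y hX hY => simp only [map_add, hX, hY, submatrix_add, Pi.add_apply]

theorem ptraceRight_tensor [Fintype B'] (Φ : Superop A B) {Ψ : Superop A' B'}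
    (hΨ : ∀ X, (Ψ X).trace = X.trace) (X : Matrix (A × A') (A × A') ℂ) :
    ptraceRight (tensor Φ Ψ X) = Φ (ptraceRight X) := by
  induction X using kronecker_induction with
  | kron X Y => rw [tensor_kronecker, ptraceRight_kronecker, ptraceRight_kronecker, hΨ, map_smul]
  | add X Y hX hY => simp only [map_add, ptraceRight_add, hX, hY]

theorem ptraceLeft_tensor [Fintype B] {Φ : Superop A B} (Ψ : Superop A' B')
    (hΦ : ∀ X, (Φ X).trace = X.trace) (X : Matrix (A × A') (A × A') ℂ) :
    ptraceLeft (tensor Φ Ψ X) = Ψ (ptraceLeft X) := by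
  induction X using kronecker_induction with
  | kron X Y => rw [tensor_kronecker, ptraceLeft_kronecker, ptraceLeft_kronecker, hΦ, map_smul]
  | add X Y hX hY => simp only [map_add, ptraceLeft_add, hX, hY]

/-- `N'` is the super-operator `N` after the relabellings `eA` and `eB` of the input and output
bases. -/
def Relabels (eA : A ≃ A') (eB : B ≃ B') (N : Superop A B) (N' : Superop A' B') : Prop :=
  ∀ X, N' X = (N (X.submatrix eA eA)).submatrix eB.symm eB.symm

theorem Relabels.tensor_id {eA : A ≃ A'} {eB : B ≃ B'} {N : Superop A B} {N' : Superop A' B'}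
    (h : Relabels eA eB N N') :
    Relabels ((Equiv.refl V).prodCongr eA) ((Equiv.refl V).prodCongr eB)
      (tensor (LinearMap.id : Superop V V) N) (tensor (LinearMap.id : Superop V V) N') := by
  intro X
  induction X using kronecker_induction with
  | kron X Y =>
    have h1 : (X ⊗ₖ Y).submatrix ((Equiv.refl V).prodCongr eA) ((Equiv.refl V).prodCongr eA) =
        X ⊗ₖ Y.submatrix eA eA := by ext; simp
    rw [h1]
    simp only [tensor_kronecker, LinearMap.id_apply, h Y]
    ext
    simp
  | add X Y hX hY => simp only [map_add, hX, hY, submatrix_add, Pi.add_apply]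

theorem tensorPow_single (n : ℕ) (Φ : Superop A B) (p q : Fin n → A) (b c : Fin n → B) :
    tensorPow n Φ (single p q 1) b c = ∏ i, Φ (single (p i) (q i) 1) (b i) (c i) := by
  have h : (single p q 1 : Matrix (Fin n → A) (Fin n → A) ℂ) =
      Matrix.of fun p' q' => ∏ i, (single (p i) (q i) (1 : ℂ)) (p' i) (q' i) := by
    ext p' q'
    simp only [single_apply, Matrix.of_apply, Finset.prod_boole, Finset.mem_univ, true_imp_iff,
      funext_iff, forall_and]
  rw [h, tensorPow_prod, Matrix.of_apply]

theorem tensorPow_succ (n : ℕ) (Φ : Superop A B) :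
    Relabels (Fin.consEquiv fun _ : Fin (n + 1) => A) (Fin.consEquiv fun _ : Fin (n + 1) => B)
      (tensor Φ (tensorPow n Φ)) (tensorPow (n + 1) Φ) := by
  intro X
  ext b c
  rw [submatrix_apply, tensor, tensorPow]
  simp only [LinearMap.coe_mk, AddHom.coe_mk, Matrix.sum_apply, Matrix.smul_apply,
    Matrix.of_apply, submatrix_apply, kroneckerMap_apply, tensorPow_single]
  refine (Fintype.sum_equiv (Fin.consEquiv fun _ : Fin (n + 1) => A) _ _ fun p => ?_).symm
  refine Fintype.sum_equiv (Fin.consEquiv fun _ : Fin (n + 1) => A) _ _ fun q => ?_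
  rw [Fin.prod_univ_succ]
  simp [Fin.consEquiv, Fin.tail]

theorem tensorPow_zero_apply (Φ : Superop A B) (X : Matrix (Fin 0 → A) (Fin 0 → A) ℂ)
    (b c : Fin 0 → B) : tensorPow 0 Φ X b c = X default default := by
  simp [tensorPow]

end Superoperators

/-! ### Complementary pairs -/

section Pairs

variable {A B E A' B' E' V : Type} [Fintype A] [DecidableEq A] [Fintype A'] [DecidableEq A']
  [Fintype B] [Fintype E] [Fintype B'] [Fintype E'] [Fintype V] [DecidableEq V]

theorem IsComplementaryPair.symm {N : Superop A B} {Nc : Superop A E}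
    (h : IsComplementaryPair N Nc) : IsComplementaryPair Nc N := by
  obtain ⟨U, hU, hN, hNc⟩ := h
  refine ⟨U.submatrix Prod.swap id, ?_, fun X => ?_, fun X => ?_⟩
  · rw [← hU]
    ext a a'
    simp only [mul_apply, conjTranspose_apply, submatrix_apply, id]
    exact Fintype.sum_equiv (Equiv.prodComm E B) _ _ fun _ => rfl
  · rw [hNc]; rfl
  · rw [hN]; rfl

theorem IsComplementaryPair.trace_eq {N : Superop A B} {Nc : Superop A E}
    (h : IsComplementaryPair N Nc) (X : Matrix A A ℂ) : (N X).trace = X.trace := by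
  obtain ⟨U, hU, hN, -⟩ := h
  rw [hN, trace_ptraceRight, trace_mul_comm, ← Matrix.mul_assoc, hU, Matrix.one_mul]

theorem IsComplementaryPair.isState {N : Superop A B} {Nc : Superop A E}
    (h : IsComplementaryPair N Nc) {ρ : Matrix A A ℂ} (hρ : IsState ρ) : IsState (N ρ) := by
  refine ⟨?_, by rw [h.trace_eq, hρ.2]⟩
  obtain ⟨U, hU, hN, -⟩ := h
  rw [hN]
  exact posSemidef_ptraceRight (hρ.1.mul_mul_conjTranspose_same U)

theorem IsComplementaryPair.tensor {N : Superop A B} {Nc : Superop A E} {M : Superop A' B'}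
    {Mc : Superop A' E'} (hN : IsComplementaryPair N Nc) (hM : IsComplementaryPair M Mc) :
    IsComplementaryPair (tensor N M) (tensor Nc Mc) := by
  obtain ⟨U, hU, hN, hNc⟩ := hN
  obtain ⟨W, hW, hM, hMc⟩ := hM
  have hconj (X : Matrix A A ℂ) (Y : Matrix A' A' ℂ) :
      (U ⊗ₖ W).submatrix (Equiv.prodProdProdComm B B' E E') id * (X ⊗ₖ Y) *
        ((U ⊗ₖ W).submatrix (Equiv.prodProdProdComm B B' E E') id)ᴴ =
      ((U * X * Uᴴ) ⊗ₖ (W * Y * Wᴴ)).submatrix (Equiv.prodProdProdComm B B' E E')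
        (Equiv.prodProdProdComm B B' E E') := by
    rw [mul_kronecker_mul, mul_kronecker_mul, ← conjTranspose_kronecker]
    rfl
  refine ⟨(U ⊗ₖ W).submatrix (Equiv.prodProdProdComm B B' E E') id, ?_, fun X => ?_, fun X => ?_⟩
  · rw [conjTranspose_submatrix, submatrix_mul_equiv, conjTranspose_kronecker,
      ← mul_kronecker_mul, hU, hW, one_kronecker_one, submatrix_id_id]
  · induction X using kronecker_induction with
    | kron X Y =>
      rw [hconj, tensor_kronecker, hN, hM]
      ext
      simp [ptraceRight, Fintype.sum_prod_type, Finset.sum_mul_sum]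
    | add X Y hX hY => simp only [map_add, Matrix.mul_add, Matrix.add_mul, ptraceRight_add, hX, hY]
  · induction X using kronecker_induction with
    | kron X Y =>
      rw [hconj, tensor_kronecker, hNc, hMc]
      ext
      simp [ptraceLeft, Fintype.sum_prod_type, Finset.sum_mul_sum]
    | add X Y hX hY => simp only [map_add, Matrix.mul_add, Matrix.add_mul, ptraceLeft_add, hX, hY]

theorem IsComplementaryPair.relabels {N : Superop A B} {Nc : Superop A E} {N' : Superop A' B'}
    {Nc' : Superop A' E'} (h : IsComplementaryPair N Nc) {eA : A ≃ A'} {eB : B ≃ B'} {eE : E ≃ E'}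
    (hN' : Relabels eA eB N N') (hNc' : Relabels eA eE Nc Nc') : IsComplementaryPair N' Nc' := by
  obtain ⟨U, hU, hN, hNc⟩ := h
  have hconj (X : Matrix A' A' ℂ) :
      U.submatrix (eB.prodCongr eE).symm eA.symm * X *
        (U.submatrix (eB.prodCongr eE).symm eA.symm)ᴴ =
      (U * X.submatrix eA eA * Uᴴ).submatrix (eB.prodCongr eE).symm (eB.prodCongr eE).symm := by
    have hX : X = (X.submatrix eA eA).submatrix eA.symm eA.symm := by ext; simp
    conv_lhs => rw [hX]
    rw [conjTranspose_submatrix, submatrix_mul_equiv, submatrix_mul_equiv]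
  refine ⟨U.submatrix (eB.prodCongr eE).symm eA.symm, ?_, fun X => ?_, fun X => ?_⟩
  · rw [conjTranspose_submatrix, submatrix_mul_equiv, hU, submatrix_one_equiv]
  · rw [hN', hN, hconj]
    ext b c
    exact Fintype.sum_equiv eE _ _ fun e => by simp
  · rw [hNc', hNc, hconj]
    ext b c
    exact Fintype.sum_equiv eB _ _ fun e => by simp

theorem IsComplementaryPair.tensorPow {N : Superop A B} {Nc : Superop A E}
    (h : IsComplementaryPair N Nc) (n : ℕ) :
    IsComplementaryPair (tensorPow n N) (tensorPow n Nc) := by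
  induction n with
  | zero =>
    refine ⟨Matrix.of fun _ _ => 1, ?_, fun X => ?_, fun X => ?_⟩
    · ext a b
      rw [Subsingleton.elim a b]
      simp [mul_apply]
    · ext b c
      simp [tensorPow_zero_apply, ptraceRight, mul_apply]
    · ext b c
      simp [tensorPow_zero_apply, ptraceLeft, mul_apply]
  | succ n ih => exact (h.tensor ih).relabels (tensorPow_succ n N) (tensorPow_succ n Nc)

/-- The identity channel is complementary to the full trace. -/
theorem exists_isComplementaryPair_id (V : Type) [Fintype V] [DecidableEq V] :
    ∃ T : Superop V Unit, IsComplementaryPair (LinearMap.id : Superop V V) T := by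
  refine ⟨{ toFun := fun X => Matrix.of fun _ _ => X.trace
            map_add' := fun X Y => by ext; simp
            map_smul' := fun c X => by ext; simp }, (1 : Matrix V V ℂ).submatrix Prod.fst id,
    ?_, fun X => ?_, fun X => ?_⟩
  · ext a b
    by_cases hab : a = b <;> simp [mul_apply, one_apply, Fintype.sum_prod_type, hab]
  · ext a b
    simp [ptraceRight, mul_apply, one_apply]
  · ext a b
    simp [ptraceLeft, mul_apply, one_apply, trace]

theorem IsComplementaryPair.isState_tensor_id {N : Superop A B} {Nc : Superop A E}
    (h : IsComplementaryPair N Nc) {ρ : Matrix (V × A) (V × A) ℂ} (hρ : IsState ρ) :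
    IsState (QInfo.tensor (LinearMap.id : Superop V V) N ρ) := by
  obtain ⟨T, hT⟩ := exists_isComplementaryPair_id V
  exact (hT.tensor h).isState hρ

theorem trace_id_superop {V : Type} [Fintype V] (X : Matrix V V ℂ) :
    ((LinearMap.id : Superop V V) X).trace = X.trace := rfl

end Pairs

/-! ### Coherent information as an entropy difference -/

section Coherent

variable {A B E A' B' E' V : Type} [Fintype A] [DecidableEq A] [Fintype A'] [DecidableEq A']
  [Fintype B] [DecidableEq B] [Fintype E] [DecidableEq E] [Fintype B'] [DecidableEq B']
  [Fintype E'] [DecidableEq E'] [Fintype V] [DecidableEq V]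

/-- The entropy difference `S(N(ρ)) - S(Nc(ρ))` between the two outputs of a pair of channels. -/
def entropyGap (N : Superop A B) (Nc : Superop A E) (ρ : Matrix A A ℂ) : ℝ :=
  vonNeumannEntropy (N ρ) - vonNeumannEntropy (Nc ρ)

/-- The purification of the input makes the joint state of reference, output and environment pure,
so that the reference and the output together have the entropy of the environment. -/
theorem coherentInfo_eq_entropyGap {N : Superop A B} {Nc : Superop A E}
    (h : IsComplementaryPair N Nc) {ρ : Matrix A A ℂ} (hρ : IsState ρ) :
    coherentInfo ρ N = entropyGap N Nc ρ := by
  have hst := h.symm.isState hρ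
  obtain ⟨U, hU, hN, hNc⟩ := h
  set s : Matrix A A ℂ := cfc Real.sqrt ρ with hs
  have hsH : sᴴ = s := (cfc_predicate Real.sqrt ρ : IsSelfAdjoint s)
  have hss : s * s = ρ := by
    -- the spectrum is finite, so every function is continuous on it
    have hcont (f : ℝ → ℝ) : ContinuousOn f (spectrum ℝ ρ) :=
      (Matrix.finite_real_spectrum (A := ρ)).continuousOn f
    rw [hs, ← cfc_mul Real.sqrt Real.sqrt ρ (hcont _) (hcont _)]
    conv_rhs => rw [← cfc_id' ℝ ρ hρ.isHermitian.isSelfAdjoint]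
    refine cfc_congr fun x hx => Real.mul_self_sqrt ?_
    rw [hρ.isHermitian.spectrum_real_eq_range_eigenvalues] at hx
    obtain ⟨i, rfl⟩ := hx
    exact hρ.1.eigenvalues_nonneg i
  -- the amplitudes of the pure state, as an operator from the environment to reference and output
  set K : Matrix (A × B) E ℂ := Matrix.of fun x e => ∑ a, U (x.2, e) a * s a x.1 with hK
  have hKU (r : A) (b : B) (e : E) : K (r, b) e = (U * s) (b, e) r := rfl
  have hRB : tensor (LinearMap.id : Superop A A) N (purification ρ) = K * Kᴴ := by
    have hgen : ∀ X : Matrix (A × A) (A × A) ℂ,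
        tensor (LinearMap.id : Superop A A) N X = Matrix.of fun x y =>
          ∑ e, ∑ a', ∑ a, U (x.2, e) a * X (x.1, a) (y.1, a') * star (U (y.2, e) a') := by
      intro X
      induction X using kronecker_induction with
      | kron X Y =>
        rw [tensor_kronecker, hN]
        ext x y
        simp only [kroneckerMap_apply, LinearMap.id_apply, ptraceRight, Matrix.of_apply, mul_apply,
          conjTranspose_apply, Finset.mul_sum, Finset.sum_mul]
        refine Finset.sum_congr rfl fun e _ => Finset.sum_congr rfl fun a' _ =>
          Finset.sum_congr rfl fun a _ => ?_
        ring
      | add X Y hX hY =>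
        rw [map_add, hX, hY]
        ext x y
        simp only [Matrix.add_apply, Matrix.of_apply, mul_add, add_mul, Finset.sum_add_distrib]
    rw [hgen]
    ext x y
    simp only [Matrix.of_apply, purification, vecMulVec_apply, Pi.star_apply, mul_apply,
      conjTranspose_apply, hK, star_sum, star_mul', Finset.sum_mul_sum]
    refine Finset.sum_congr rfl fun e _ => ?_
    rw [Finset.sum_comm]
    refine Finset.sum_congr rfl fun a _ => Finset.sum_congr rfl fun a' _ => ?_
    rw [← hs]
    ring
  have hE : (Nc ρ)ᵀ = Kᴴ * K := by
    have h1 : U * ρ * Uᴴ = (U * s) * (U * s)ᴴ := by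
      rw [conjTranspose_mul, hsH, ← hss]
      simp only [Matrix.mul_assoc]
    rw [hNc, h1]
    ext e f
    simp only [transpose_apply, ptraceLeft, Matrix.of_apply, mul_apply (M := U * s),
      mul_apply (M := Kᴴ), conjTranspose_apply, Fintype.sum_prod_type, hKU]
    rw [Finset.sum_comm]
    exact Finset.sum_congr rfl fun a _ => Finset.sum_congr rfl fun b _ => mul_comm _ _
  rw [coherentInfo, entropyGap, hRB, entropy_mul_conjTranspose_comm, ← hE,
    entropy_transpose hst.isHermitian]

theorem entropyGap_le_maxCoherentInfo {N : Superop A B} {Nc : Superop A E}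
    (h : IsComplementaryPair N Nc) {ρ : Matrix A A ℂ} (hρ : IsState ρ) :
    entropyGap N Nc ρ ≤ maxCoherentInfo N := by
  -- the supremum is over a bounded set, since `0 ≤ S ≤ card` on states
  refine le_csSup ⟨Fintype.card B, ?_⟩ ⟨ρ, hρ, (coherentInfo_eq_entropyGap h hρ).symm⟩
  rintro x ⟨σ, hσ, rfl⟩
  rw [coherentInfo_eq_entropyGap h hσ, entropyGap]
  have h1 := entropy_le_card (h.isState hσ)
  have h2 := entropy_nonneg (h.symm.isState hσ)
  linarith

theorem exists_isState [Nonempty A] : ∃ ρ : Matrix A A ℂ, IsState ρ := by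
  obtain ⟨a⟩ := ‹Nonempty A›
  refine ⟨single a a 1, ?_, by simp⟩
  rw [← diagonal_single]
  exact PosSemidef.diagonal fun i => by
    by_cases hi : i = a
    · subst hi; simp
    · simp [hi]

theorem maxCoherentInfo_le [Nonempty A] {N : Superop A B} {Nc : Superop A E}
    (h : IsComplementaryPair N Nc) {c : ℝ} (hc : ∀ ρ, IsState ρ → entropyGap N Nc ρ ≤ c) :
    maxCoherentInfo N ≤ c := by
  obtain ⟨ρ, hρ⟩ := exists_isState (A := A)
  refine csSup_le ⟨_, ρ, hρ, rfl⟩ ?_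
  rintro x ⟨σ, hσ, rfl⟩
  rw [coherentInfo_eq_entropyGap h hσ]
  exact hc σ hσ

theorem entropyGap_relabels {A' : Type} [Fintype A'] {N : Superop A B} {Nc : Superop A E}
    {N' : Superop A' B'}
    {Nc' : Superop A' E'} (h : IsComplementaryPair N Nc) {eA : A ≃ A'} {eB : B ≃ B'} {eE : E ≃ E'}
    (hN' : Relabels eA eB N N') (hNc' : Relabels eA eE Nc Nc') {ρ : Matrix A' A' ℂ}
    (hρ : IsState ρ) : entropyGap N' Nc' ρ = entropyGap N Nc (ρ.submatrix eA eA) := by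
  have hρ' := hρ.submatrix_equiv eA
  rw [entropyGap, entropyGap, hN', hNc', entropy_submatrix_equiv _ (h.isState hρ').isHermitian,
    entropy_submatrix_equiv _ (h.symm.isState hρ').isHermitian]

theorem entropyGap_tensor_kronecker {N : Superop A B} {Nc : Superop A E} {M : Superop A' B'}
    {Mc : Superop A' E'} (hN : IsComplementaryPair N Nc) (hM : IsComplementaryPair M Mc)
    {ρ : Matrix A A ℂ} {σ : Matrix A' A' ℂ} (hρ : IsState ρ) (hσ : IsState σ) :
    entropyGap (tensor N M) (tensor Nc Mc) (ρ ⊗ₖ σ) = entropyGap N Nc ρ + entropyGap M Mc σ := by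
  simp only [entropyGap, tensor_kronecker]
  rw [entropy_kronecker (hN.isState hρ) (hM.isState hσ),
    entropy_kronecker (hN.symm.isState hρ) (hM.symm.isState hσ)]
  ring

theorem entropy_eq_zero_of_unique {A : Type} [Fintype A] [DecidableEq A] [Unique A]
    {ρ : Matrix A A ℂ} (hρ : IsState ρ) : vonNeumannEntropy ρ = 0 := by
  have h1 : ρ default default = 1 := by simpa [trace] using hρ.2
  have h2 : ρ = diagonal fun _ => ((1 : ℝ) : ℂ) := by
    ext a b
    rw [Subsingleton.elim a default, Subsingleton.elim b default, h1]
    simp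
  rw [h2, entropy_diagonal fun _ => (1 : ℝ)]
  simp

theorem entropyGap_tensorPow_zero {N : Superop A B} {Nc : Superop A E}
    (h : IsComplementaryPair N Nc) {ρ : Matrix (Fin 0 → A) (Fin 0 → A) ℂ} (hρ : IsState ρ) :
    entropyGap (tensorPow 0 N) (tensorPow 0 Nc) ρ = 0 := by
  rw [entropyGap, entropy_eq_zero_of_unique ((h.tensorPow 0).isState hρ),
    entropy_eq_zero_of_unique ((h.tensorPow 0).symm.isState hρ), sub_zero]

/-- The tensor powers of a state have additive entropy differences. -/
theorem exists_entropyGap_tensorPow_eq {N : Superop A B} {Nc : Superop A E}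
    (h : IsComplementaryPair N Nc) {ρ : Matrix A A ℂ} (hρ : IsState ρ) (n : ℕ) :
    ∃ σ, IsState σ ∧ entropyGap (tensorPow n N) (tensorPow n Nc) σ = n * entropyGap N Nc ρ := by
  induction n with
  | zero =>
    obtain ⟨σ, hσ⟩ := exists_isState (A := Fin 0 → A)
    exact ⟨σ, hσ, by rw [entropyGap_tensorPow_zero h hσ]; simp⟩
  | succ n ih =>
    obtain ⟨σ, hσ, hgap⟩ := ih
    have hprod := hρ.kronecker hσ
    refine ⟨_, hprod.submatrix_equiv (Fin.consEquiv fun _ : Fin (n + 1) => A).symm, ?_⟩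
    rw [entropyGap_relabels (h.tensor (h.tensorPow n)) (tensorPow_succ n N) (tensorPow_succ n Nc)
      (hprod.submatrix_equiv _), submatrix_submatrix]
    simp only [Equiv.symm_comp_self, submatrix_id_id]
    rw [entropyGap_tensor_kronecker h (h.tensorPow n) hρ hσ, hgap]
    push_cast
    ring

theorem mul_maxCoherentInfo_le [Nonempty A] {N : Superop A B} {Nc : Superop A E}
    (h : IsComplementaryPair N Nc) (n : ℕ) :
    n * maxCoherentInfo N ≤ maxCoherentInfo (tensorPow n N) := by
  rcases Nat.eq_zero_or_pos n with rfl | hn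
  · obtain ⟨σ, hσ⟩ := exists_isState (A := Fin 0 → A)
    have := entropyGap_le_maxCoherentInfo (h.tensorPow 0) hσ
    rw [entropyGap_tensorPow_zero h hσ] at this
    simpa using this
  have hn' : (0 : ℝ) < n := by exact_mod_cast hn
  rw [mul_comm, ← le_div_iff₀ hn']
  refine maxCoherentInfo_le h fun ρ hρ => ?_
  obtain ⟨σ, hσ, hgap⟩ := exists_entropyGap_tensorPow_eq h hρ n
  rw [le_div_iff₀ hn', mul_comm, ← hgap]
  exact entropyGap_le_maxCoherentInfo (h.tensorPow n) hσ

theorem maxCoherentInfo_add_le [Nonempty A] [Nonempty A'] {N : Superop A B} {Nc : Superop A E}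
    {M : Superop A' B'} {Mc : Superop A' E'} (hN : IsComplementaryPair N Nc)
    (hM : IsComplementaryPair M Mc) :
    maxCoherentInfo N + maxCoherentInfo M ≤ maxCoherentInfo (tensor N M) := by
  rw [← le_sub_iff_add_le]
  refine maxCoherentInfo_le hN fun ρ hρ => ?_
  rw [le_sub_comm]
  refine maxCoherentInfo_le hM fun σ hσ => ?_
  rw [le_sub_iff_add_le', ← entropyGap_tensor_kronecker hN hM hρ hσ]
  exact entropyGap_le_maxCoherentInfo (hN.tensor hM) (hρ.kronecker hσ)

end Coherent

/-! ### Informational degradability and conditional entropies -/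

section Degradable

variable {A B E A' B' E' V : Type} [Fintype A] [DecidableEq A] [Fintype A'] [DecidableEq A']
  [Fintype B] [DecidableEq B] [Fintype E] [DecidableEq E] [Fintype B'] [DecidableEq B']
  [Fintype E'] [DecidableEq E'] [Fintype V] [DecidableEq V]

/-- `S(V B) ≤ S(V E) + c` for every system `V` and every state of `V` and the input: the entropy
difference between the outputs of `N` and `Nc` is at most `c` even in the presence of a quantum
bystander. -/
def StableGapLE (N : Superop A B) (Nc : Superop A E) (c : ℝ) : Prop :=
  ∀ (V : Type) [Fintype V] [DecidableEq V] (ρ : Matrix (V × A) (V × A) ℂ), IsState ρ →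
    vonNeumannEntropy (tensor (LinearMap.id : Superop V V) N ρ) ≤
      vonNeumannEntropy (tensor (LinearMap.id : Superop V V) Nc ρ) + c

theorem StableGapLE.entropyGap_le {N : Superop A B} {Nc : Superop A E} {c : ℝ}
    (h : StableGapLE N Nc c) (hN : IsComplementaryPair N Nc) {ρ : Matrix A A ℂ}
    (hρ : IsState ρ) : entropyGap N Nc ρ ≤ c := by
  -- the bystander is taken one-dimensional
  have h1 : IsState (1 : Matrix Unit Unit ℂ) := ⟨PosSemidef.one, by simp⟩
  have := h Unit (1 ⊗ₖ ρ) (h1.kronecker hρ)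
  rw [tensor_kronecker, tensor_kronecker, LinearMap.id_apply, entropy_kronecker h1 (hN.isState hρ),
    entropy_kronecker h1 (hN.symm.isState hρ)] at this
  rw [entropyGap]
  linarith

/-- The entropy of the bystander cancels between the two mutual informations, and what remains is
bounded by the coherent information of the marginal on the input. -/
theorem stableGapLE_of_mutualInfo_le {N : Superop A B} {Nc : Superop A E}
    (h : IsComplementaryPair N Nc)
    (hdeg : ∀ (V : Type) [Fintype V] [DecidableEq V] (ρ : Matrix (V × A) (V × A) ℂ), IsState ρ →
      mutualInfo (tensor (LinearMap.id : Superop V V) Nc ρ) ≤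
        mutualInfo (tensor (LinearMap.id : Superop V V) N ρ)) :
    StableGapLE N Nc (maxCoherentInfo N) := by
  intro V _ _ ρ hρ
  have h1 := hdeg V ρ hρ
  have h2 := entropyGap_le_maxCoherentInfo h hρ.ptraceLeft
  rw [mutualInfo, mutualInfo, ptraceRight_tensor _ h.trace_eq, ptraceRight_tensor _ h.symm.trace_eq,
    ptraceLeft_tensor _ trace_id_superop, ptraceLeft_tensor _ trace_id_superop] at h1
  rw [entropyGap] at h2
  linarith

theorem StableGapLE.relabels {N : Superop A B} {Nc : Superop A E} {N' : Superop A' B'}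
    {Nc' : Superop A' E'} {c : ℝ} (h : StableGapLE N Nc c) (hN : IsComplementaryPair N Nc)
    {eA : A ≃ A'} {eB : B ≃ B'} {eE : E ≃ E'}
    (hN' : Relabels eA eB N N') (hNc' : Relabels eA eE Nc Nc') : StableGapLE N' Nc' c := by
  intro V _ _ ρ hρ
  have hρ' := hρ.submatrix_equiv ((Equiv.refl V).prodCongr eA)
  rw [hN'.tensor_id (V := V), hNc'.tensor_id (V := V),
    entropy_submatrix_equiv _ (hN.isState_tensor_id hρ').isHermitian,
    entropy_submatrix_equiv _ (hN.symm.isState_tensor_id hρ').isHermitian]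
  exact h V _ hρ'

/-- One tensor factor is replaced by its complement at the cost of its own bound, the output of the
other factor being absorbed into the bystander. -/
theorem StableGapLE.tensor_right {E' : Type} [Fintype E']
    {N : Superop A B} {Nc : Superop A E} {c : ℝ}
    (h : StableGapLE N Nc c) (hN : IsComplementaryPair N Nc) {M : Superop A' B'}
    {Mc : Superop A' E'} (hM : IsComplementaryPair M Mc)
    {ρ : Matrix (V × A' × A) (V × A' × A) ℂ} (hρ : IsState ρ) :
    vonNeumannEntropy (tensor (LinearMap.id : Superop V V) (tensor M N) ρ) ≤
      vonNeumannEntropy (tensor (LinearMap.id : Superop V V) (tensor M Nc) ρ) + c := by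
  obtain ⟨T, hT⟩ := exists_isComplementaryPair_id V
  obtain ⟨T', hT'⟩ := exists_isComplementaryPair_id A
  have hρ' := hρ.submatrix_equiv (Equiv.prodAssoc V A' A)
  have hVM := hT.tensor hM
  have hB := entropy_submatrix_equiv (Equiv.prodAssoc V B' B).symm
    ((hVM.tensor hN).isState hρ').isHermitian
  have hE := entropy_submatrix_equiv (Equiv.prodAssoc V B' E).symm
    ((hVM.tensor hN.symm).isState hρ').isHermitian
  have key := h (V × B') _ ((hVM.tensor hT').isState hρ')
  rw [tensor_id_comp_tensor_id, tensor_id_comp_tensor_id] at key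
  rw [tensor_assoc, tensor_assoc, hB, hE]
  exact key

theorem StableGapLE.tensor_left {E' : Type} [Fintype E']
    {N : Superop A B} {Nc : Superop A E} {c : ℝ}
    (h : StableGapLE N Nc c) (hN : IsComplementaryPair N Nc) {M : Superop A' B'}
    {Mc : Superop A' E'} (hM : IsComplementaryPair M Mc)
    {ρ : Matrix (V × A × A') (V × A × A') ℂ} (hρ : IsState ρ) :
    vonNeumannEntropy (tensor (LinearMap.id : Superop V V) (tensor N M) ρ) ≤
      vonNeumannEntropy (tensor (LinearMap.id : Superop V V) (tensor Nc M) ρ) + c := by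
  have hrel {C : Type} (Φ : Superop A C) :
      Relabels (Equiv.prodComm A' A) (Equiv.prodComm B' C) (tensor M Φ) (tensor Φ M) :=
    fun X => tensor_swap Φ M X
  have hρ' := hρ.submatrix_equiv ((Equiv.refl V).prodCongr (Equiv.prodComm A' A))
  rw [(hrel N).tensor_id (V := V), (hrel Nc).tensor_id (V := V),
    entropy_submatrix_equiv _ ((hM.tensor hN).isState_tensor_id hρ').isHermitian,
    entropy_submatrix_equiv _ ((hM.tensor hN.symm).isState_tensor_id hρ').isHermitian]
  exact h.tensor_right hN hM hρ'

theorem StableGapLE.tensor {N : Superop A B} {Nc : Superop A E} {M : Superop A' B'}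
    {Mc : Superop A' E'} {c d : ℝ} (h : StableGapLE N Nc c) (hN : IsComplementaryPair N Nc)
    (h' : StableGapLE M Mc d) (hM : IsComplementaryPair M Mc) :
    StableGapLE (tensor N M) (tensor Nc Mc) (c + d) := by
  intro V _ _ ρ hρ
  have h1 := h.tensor_left hN hM hρ
  have h2 := h'.tensor_right hM hN.symm hρ
  linarith

theorem StableGapLE.tensorPow {N : Superop A B} {Nc : Superop A E} {c : ℝ}
    (h : StableGapLE N Nc c) (hN : IsComplementaryPair N Nc) (n : ℕ) :
    StableGapLE (tensorPow n N) (tensorPow n Nc) (n * c) := by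
  induction n with
  | zero =>
    intro V _ _ ρ hρ
    have key {C : Type} [Fintype C] [DecidableEq C] (Φ : Superop A C) :
        vonNeumannEntropy (QInfo.tensor (LinearMap.id : Superop V V) (QInfo.tensorPow 0 Φ) ρ) =
          vonNeumannEntropy ρ := by
      have : QInfo.tensor (LinearMap.id : Superop V V) (QInfo.tensorPow 0 Φ) ρ =
          ρ.submatrix ((Equiv.refl V).prodCongr (Equiv.ofUnique (Fin 0 → C) (Fin 0 → A)))
            ((Equiv.refl V).prodCongr (Equiv.ofUnique (Fin 0 → C) (Fin 0 → A))) := by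
        clear hρ
        induction ρ using kronecker_induction with
        | kron X Y =>
          rw [tensor_kronecker]
          ext x y
          simp only [kroneckerMap_apply, LinearMap.id_apply, tensorPow_zero_apply, submatrix_apply,
            Equiv.prodCongr_apply, Prod.map]
          congr 2
        | add X Y hX hY => simp only [map_add, hX, hY, submatrix_add, Pi.add_apply]
      rw [this, entropy_submatrix_equiv _ hρ.isHermitian]
    rw [key, key]
    simp
  | succ n ih =>
    have := (h.tensor hN ih (hN.tensorPow n)).relabels (hN.tensor (hN.tensorPow n))
      (tensorPow_succ n N) (tensorPow_succ n Nc)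
    have hc : c + n * c = ((n + 1 : ℕ) : ℝ) * c := by push_cast; ring
    exact hc ▸ this

end Degradable

/-! ### Less noisy channels and concavity -/

section LessNoisy

variable {A B E A' B' E' X : Type} [Fintype A] [DecidableEq A] [Fintype A'] [DecidableEq A']
  [Fintype B] [DecidableEq B] [Fintype E] [DecidableEq E] [Fintype B'] [DecidableEq B']
  [Fintype E'] [DecidableEq E'] [Fintype X] [DecidableEq X]

theorem charpoly_blockDiagonal (D : X → Matrix A A ℂ) :
    (blockDiagonal D).charpoly = ∏ x, (D x).charpoly := by
  have h : (blockDiagonal D).charmatrix = blockDiagonal fun x => (D x).charmatrix := by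
    ext ⟨a, x⟩ ⟨b, y⟩ : 2
    by_cases hxy : x = y
    · subst hxy
      by_cases hab : a = b
      · subst hab; simp [blockDiagonal_apply]
      · simp [blockDiagonal_apply, hab]
    · simp [blockDiagonal_apply, hxy]
  rw [charpoly, h, det_blockDiagonal]
  rfl

theorem entropy_smul {ρ : Matrix A A ℂ} (hρ : IsState ρ) (p : ℝ) :
    vonNeumannEntropy ((p : ℂ) • ρ) = Real.negMulLog p + p * vonNeumannEntropy ρ := by
  obtain ⟨U, r, hU, hr, hspec⟩ := exists_unitary_diagonalization hρ.1
  have hdiag (w : A → ℝ) : (diagonal fun a => (w a : ℂ)).IsHermitian :=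
    isHermitian_diagonal_of_self_adjoint _ (by ext; simp)
  have hsum : ∑ a, r a = 1 := by
    have := hρ.2
    rw [hspec, trace_mul_comm, ← mul_assoc, hU, one_mul, trace_diagonal] at this
    exact_mod_cast this
  have hsmul : (p : ℂ) • ρ = U * diagonal (fun a => ((p * r a : ℝ) : ℂ)) * Uᴴ := by
    conv_lhs => rw [hspec, ← smul_mul_assoc, ← mul_smul_comm, ← diagonal_smul]
    simp [Pi.smul_def]
  rw [hsmul, entropy_unitary_conj hU (hdiag _), entropy_diagonal]
  conv_rhs => rw [hspec, entropy_unitary_conj hU (hdiag _), entropy_diagonal]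
  simp only [Real.negMulLog_mul, Finset.sum_add_distrib, ← Finset.sum_mul, ← Finset.mul_sum, hsum,
    one_mul]

theorem entropy_cqState (p : X → ℝ) {σ : X → Matrix A A ℂ} (hσ : ∀ x, IsState (σ x)) :
    vonNeumannEntropy (cqState p σ) =
      ∑ x, (Real.negMulLog (p x) + p x * vonNeumannEntropy (σ x)) := by
  have hblock : cqState p σ =
      (blockDiagonal fun x => (p x : ℂ) • σ x).submatrix (Equiv.prodComm X A)
        (Equiv.prodComm X A) := by
    ext ⟨x, a⟩ ⟨y, b⟩
    by_cases hxy : x = y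
    · subst hxy
      simp [cqState, Matrix.sum_apply, blockDiagonal_apply, single_apply]
    · simp only [cqState, Matrix.sum_apply, submatrix_apply, blockDiagonal_apply,
        Equiv.prodComm_apply, Prod.swap, hxy, if_false]
      refine Finset.sum_eq_zero fun z _ => ?_
      have : ¬(z = x ∧ z = y) := fun h => hxy (h.1 ▸ h.2)
      simp [this]
  have hH (x : X) : ((p x : ℂ) • σ x).IsHermitian := by
    rw [IsHermitian, conjTranspose_smul, (hσ x).isHermitian.eq]
    simp
  have hHb : (blockDiagonal fun x => (p x : ℂ) • σ x).IsHermitian := by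
    rw [IsHermitian, blockDiagonal_conjTranspose]
    exact congrArg blockDiagonal (funext fun x => hH x)
  rw [hblock, entropy_submatrix_equiv _ hHb, entropy_eq_rootEntropy hHb, charpoly_blockDiagonal,
    rootEntropy_prod _ _ fun x => (charpoly_monic _).ne_zero]
  refine Finset.sum_congr rfl fun x _ => ?_
  rw [← entropy_eq_rootEntropy (hH x), entropy_smul (hσ x)]

theorem tensor_id_cqState {B : Type} (Φ : Superop A B) (p : X → ℝ) (σ : X → Matrix A A ℂ) :
    tensor (LinearMap.id : Superop X X) Φ (cqState p σ) = cqState p fun x => Φ (σ x) := by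
  simp only [cqState, map_sum, map_smul, tensor_kronecker, LinearMap.id_apply]

theorem ptraceLeft_cqState {A : Type} (p : X → ℝ) (σ : X → Matrix A A ℂ) :
    ptraceLeft (cqState p σ) = ∑ x, (p x : ℂ) • σ x := by
  ext a b
  simp only [cqState, ptraceLeft, Matrix.of_apply, Matrix.sum_apply, Matrix.smul_apply,
    kroneckerMap_apply, smul_eq_mul]
  rw [Finset.sum_comm]
  refine Finset.sum_congr rfl fun x _ => ?_
  simp [single_apply]

/-- Comparing the mutual informations of two-letter ensembles amounts to the concavity of the
entropy difference. -/
theorem entropyGap_concave_of_mutualInfo_le {N : Superop A B} {Nc : Superop A E}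
    (h : IsComplementaryPair N Nc)
    (hln : ∀ (p : Bool → ℝ) (σ : Bool → Matrix A A ℂ),
      (∀ x, 0 ≤ p x) → ∑ x, p x = 1 → (∀ x, IsState (σ x)) →
      mutualInfo (tensor (LinearMap.id : Superop Bool Bool) Nc (cqState p σ)) ≤
        mutualInfo (tensor (LinearMap.id : Superop Bool Bool) N (cqState p σ)))
    {ρ σ : Matrix A A ℂ} (hρ : IsState ρ) (hσ : IsState σ) {t : ℝ} (h0 : 0 ≤ t) (h1 : t ≤ 1) :
    (1 - t) * entropyGap N Nc ρ + t * entropyGap N Nc σ ≤ entropyGap N Nc (mix t ρ σ) := by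
  have key := hln (fun x => cond x t (1 - t)) (fun x => cond x σ ρ)
    (by rintro (_ | _) <;> simp [h0, h1]) (by simp) (by rintro (_ | _) <;> assumption)
  -- the letter `true` carries `σ` with weight `t`
  have hmix : ptraceLeft (cqState (fun x => cond x t (1 - t)) fun x => cond x σ ρ) =
      mix t ρ σ := by
    rw [ptraceLeft_cqState, Fintype.sum_bool, add_comm]
    rfl
  rw [mutualInfo, mutualInfo, ptraceRight_tensor _ h.trace_eq, ptraceRight_tensor _ h.symm.trace_eq,
    ptraceLeft_tensor _ trace_id_superop, ptraceLeft_tensor _ trace_id_superop, hmix,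
    tensor_id_cqState, tensor_id_cqState,
    entropy_cqState _ (by rintro (_ | _); exacts [h.symm.isState hρ, h.symm.isState hσ]),
    entropy_cqState _ (by rintro (_ | _); exacts [h.isState hρ, h.isState hσ])] at key
  simp only [Fintype.sum_bool, cond_true, cond_false] at key
  simp only [entropyGap]
  linarith

/-- If the entropy difference of a product channel is concave, then it is subadditive: along the
segment from the product of the marginals of `σ` to `σ` the output entropy never exceeds its initial
value, and the environment entropy drops at most quadratically, so that the initial slope, which by
concavity bounds the total increase, is nonpositive. -/
theorem entropyGap_tensor_le_of_concave {N : Superop A B} {Nc : Superop A E} {M : Superop A' B'}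
    {Mc : Superop A' E'} (hN : IsComplementaryPair N Nc) (hM : IsComplementaryPair M Mc)
    (hconc : ∀ ρ σ, IsState ρ → IsState σ → ∀ t : ℝ, 0 ≤ t → t ≤ 1 →
      (1 - t) * entropyGap (tensor N M) (tensor Nc Mc) ρ +
        t * entropyGap (tensor N M) (tensor Nc Mc) σ ≤
          entropyGap (tensor N M) (tensor Nc Mc) (mix t ρ σ))
    {σ : Matrix (A × A') (A × A') ℂ} (hσ : IsState σ) :
    entropyGap (tensor N M) (tensor Nc Mc) σ ≤
      entropyGap N Nc (ptraceRight σ) + entropyGap M Mc (ptraceLeft σ) := by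
  have hprod := hσ.ptraceRight.kronecker hσ.ptraceLeft
  have hNM := hN.tensor hM
  have hgap := entropyGap_tensor_kronecker hN hM hσ.ptraceRight hσ.ptraceLeft
  obtain ⟨C, hC⟩ := entropy_mix_product_ge (hNM.symm.isState hσ)
  rw [ptraceRight_tensor _ hM.symm.trace_eq, ptraceLeft_tensor _ hN.symm.trace_eq] at hC
  rw [← hgap]
  set F := entropyGap (tensor N M) (tensor Nc Mc) with hF
  have hbound (t : ℝ) (h0 : 0 < t) (h1 : t ≤ 1) :
      F σ - F (ptraceRight σ ⊗ₖ ptraceLeft σ) ≤ C * t := by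
    have hc := hconc _ _ hprod hσ t h0.le h1
    have hE := hC t h0.le h1
    -- the marginals of the mixture do not depend on `t`
    have hB := entropy_subadditive (hNM.isState (hprod.mix hσ h0.le h1))
    rw [ptraceRight_tensor _ hM.trace_eq, ptraceLeft_tensor _ hN.trace_eq, ptraceRight_mix,
      ptraceLeft_mix, ptraceRight_kronecker, ptraceLeft_kronecker, hσ.ptraceLeft.2,
      hσ.ptraceRight.2, one_smul, one_smul, mix_self, mix_self] at hB
    have hmix : F (mix t (ptraceRight σ ⊗ₖ ptraceLeft σ) σ) ≤
        F (ptraceRight σ ⊗ₖ ptraceLeft σ) + C * t ^ 2 := by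
      rw [hgap, hF]
      simp only [entropyGap]
      rw [map_mix (tensor Nc Mc), tensor_kronecker]
      linarith
    have : t * (F σ - F (ptraceRight σ ⊗ₖ ptraceLeft σ)) ≤ t * (C * t) := by
      linarith [hc, hmix]
    exact le_of_mul_le_mul_left this h0
  have hlim : Filter.Tendsto (fun t : ℝ => C * t) (nhdsWithin 0 (Set.Ioi 0)) (nhds 0) := by
    have : Filter.Tendsto (fun t : ℝ => C * t) (nhds 0) (nhds (C * 0)) :=
      (continuous_const.mul continuous_id).tendsto 0
    rw [mul_zero] at this
    exact this.mono_left nhdsWithin_le_nhds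
  refine sub_nonpos.1 (ge_of_tendsto hlim ?_)
  filter_upwards [Ioc_mem_nhdsGT (zero_lt_one' ℝ)] with t ht
  exact hbound t ht.1 ht.2

theorem entropyGap_tensorPow_le {N : Superop A B} {Nc : Superop A E}
    (h : IsComplementaryPair N Nc)
    (hconc : ∀ n : ℕ, 1 ≤ n → ∀ ρ σ, IsState ρ → IsState σ → ∀ t : ℝ, 0 ≤ t → t ≤ 1 →
      (1 - t) * entropyGap (tensorPow n N) (tensorPow n Nc) ρ +
        t * entropyGap (tensorPow n N) (tensorPow n Nc) σ ≤
          entropyGap (tensorPow n N) (tensorPow n Nc) (mix t ρ σ))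
    (n : ℕ) {σ : Matrix (Fin n → A) (Fin n → A) ℂ} (hσ : IsState σ) :
    entropyGap (tensorPow n N) (tensorPow n Nc) σ ≤ n * maxCoherentInfo N := by
  induction n with
  | zero => rw [entropyGap_tensorPow_zero h hσ]; simp
  | succ n ih =>
    have hrel {τ : Matrix (Fin (n + 1) → A) (Fin (n + 1) → A) ℂ} (hτ : IsState τ) :=
      entropyGap_relabels (h.tensor (h.tensorPow n)) (tensorPow_succ n N) (tensorPow_succ n Nc) hτ
    set e := Fin.consEquiv fun _ : Fin (n + 1) => A with he
    have hrel' {τ : Matrix (A × (Fin n → A)) (A × (Fin n → A)) ℂ} (hτ : IsState τ) :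
        entropyGap (tensor N (tensorPow n N)) (tensor Nc (tensorPow n Nc)) τ =
          entropyGap (tensorPow (n + 1) N) (tensorPow (n + 1) Nc)
            (τ.submatrix e.symm e.symm) := by
      rw [hrel (hτ.submatrix_equiv e.symm), submatrix_submatrix, Equiv.symm_comp_self,
        submatrix_id_id]
    have hσ' := hσ.submatrix_equiv e
    rw [hrel hσ]
    refine (entropyGap_tensor_le_of_concave h (h.tensorPow n) (fun ρ τ hρ hτ t h0 h1 => ?_)
      hσ').trans ?_
    · rw [hrel' hρ, hrel' hτ, hrel' (hρ.mix hτ h0 h1)]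
      exact hconc (n + 1) (by omega) _ _ (hρ.submatrix_equiv e.symm)
        (hτ.submatrix_equiv e.symm) t h0 h1
    · have h1 := entropyGap_le_maxCoherentInfo h hσ'.ptraceRight
      have h2 := ih hσ'.ptraceLeft
      push_cast
      linarith

end LessNoisy

/-! ### Additivity of the maximal coherent information -/

section Additivity

variable {A B A' B' : Type} [Fintype A] [DecidableEq A] [Nonempty A] [Fintype B] [DecidableEq B]
  [Fintype A'] [DecidableEq A'] [Nonempty A'] [Fintype B'] [DecidableEq B']

theorem RegularizedLessNoisy.maxCoherentInfo_tensorPow {N : Superop A B}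
    (h : RegularizedLessNoisy N) (n : ℕ) :
    maxCoherentInfo (tensorPow n N) = n * maxCoherentInfo N := by
  obtain ⟨e, Nc, hN, hln⟩ := h
  refine le_antisymm (maxCoherentInfo_le (hN.tensorPow n) fun σ hσ => ?_)
    (mul_maxCoherentInfo_le hN n)
  exact entropyGap_tensorPow_le hN (fun k hk ρ τ hρ hτ t h0 h1 =>
    entropyGap_concave_of_mutualInfo_le (hN.tensorPow k) (hln k hk Bool) hρ hτ h0 h1) n hσ

theorem InformationallyDegradable.maxCoherentInfo_tensorPow {N : Superop A B}
    (h : InformationallyDegradable N) (n : ℕ) :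
    maxCoherentInfo (tensorPow n N) = n * maxCoherentInfo N := by
  obtain ⟨e, Nc, hN, hdeg⟩ := h
  have hgap := (stableGapLE_of_mutualInfo_le hN hdeg).tensorPow hN n
  exact le_antisymm (maxCoherentInfo_le (hN.tensorPow n) fun σ hσ =>
    hgap.entropyGap_le (hN.tensorPow n) hσ) (mul_maxCoherentInfo_le hN n)

theorem InformationallyDegradable.maxCoherentInfo_tensor_tensorPow {N : Superop A B}
    {M : Superop A' B'} (h : InformationallyDegradable N) (h' : InformationallyDegradable M)
    (n m : ℕ) :
    maxCoherentInfo (tensor (tensorPow n N) (tensorPow m M)) =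
      n * maxCoherentInfo N + m * maxCoherentInfo M := by
  obtain ⟨e, Nc, hN, hdeg⟩ := h
  obtain ⟨e', Mc, hM, hdeg'⟩ := h'
  have hgap := ((stableGapLE_of_mutualInfo_le hN hdeg).tensorPow hN n).tensor (hN.tensorPow n)
    ((stableGapLE_of_mutualInfo_le hM hdeg').tensorPow hM m) (hM.tensorPow m)
  have hNM := (hN.tensorPow n).tensor (hM.tensorPow m)
  refine le_antisymm (maxCoherentInfo_le hNM fun σ hσ => hgap.entropyGap_le hNM hσ) ?_
  exact (add_le_add (mul_maxCoherentInfo_le hN n) (mul_maxCoherentInfo_le hM m)).trans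
    (maxCoherentInfo_add_le (hN.tensorPow n) (hM.tensorPow m))

end Additivity

end QInfo

end

theorem mainTheorem1 {A B A' B' : Type}
    [Fintype A] [DecidableEq A] [Nonempty A] [Fintype B] [DecidableEq B]
    [Fintype A'] [DecidableEq A'] [Nonempty A'] [Fintype B'] [DecidableEq B']
    (N : QInfo.Superop A B) (M : QInfo.Superop A' B')
    (hN : QInfo.IsChannel N) (hM : QInfo.IsChannel M) :
    (QInfo.RegularizedLessNoisy N → ∀ n : ℕ, 1 ≤ n →
      QInfo.maxCoherentInfo (QInfo.tensorPow n N) = n * QInfo.maxCoherentInfo N) ∧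
    (QInfo.InformationallyDegradable N → QInfo.InformationallyDegradable M →
      ∀ n m : ℕ, 1 ≤ n → 1 ≤ m →
        QInfo.maxCoherentInfo (QInfo.tensor (QInfo.tensorPow n N) (QInfo.tensorPow m M)) =
          n * QInfo.maxCoherentInfo N + m * QInfo.maxCoherentInfo M) ∧
    (QInfo.InformationallyDegradable N → ∀ n : ℕ, 1 ≤ n →
      QInfo.maxCoherentInfo (QInfo.tensorPow n N) = n * QInfo.maxCoherentInfo N) := by
  exact ⟨fun h n _ => h.maxCoherentInfo_tensorPow n,
    fun h h' n m _ _ => h.maxCoherentInfo_tensor_tensorPow h' n m,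
    fun h n _ => h.maxCoherentInfo_tensorPow n⟩
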